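/- For a compactly supported probability measure $\mu$ on $\mathbb R$ let $m_n=\int t^n\,d\mu(t)$ be its moments, $G_\mu(z)=\int\frac{1}{z-t}\,d\mu(t)$ its Cauchy transform, and $$\kappa_n=\sum_{\pi\in NC(n)}\Bigl(\prod_{V\in\pi}m_{\#V}\Bigr)\,\mathrm{M\ddot ob}(\pi,1_n)\qquad(n\ge 1)$$ its free cumulants, where $NC(n)$ is the lattice of non-crossing partitions of $\{1,\dots,n\}$ ordered by refinement, $1_n$ is its largest element and $\mathrm{M\ddot ob}$ is its Möbius function. For compactly supported probability measures $\mu,\nu$ on $\mathbb R$, the free convolution $\mu\boxplus\nu$ is the compactly supported probability measure whose moments are $(\varphi((x+y)^n))_n$, where $x,y$ are self-adjoint elements of a $*$-probability space $(\mathcal A,\varphi)$ (a unital complex $*$-algebra with a unital positive linear functional) that are freely independent and whose moments are those of $\mu$ and $\nu$, respectively. (1) Let $\mu$ be a probability measure on $\mathbb R$ with $\mu([-r,r])=1$ for some $r>0$. Put $G=G_\mu$, $U=\{z\in\mathbb C: |z|>4r\}$ and $V=\{z\in\mathbb C: |z|<\frac1{6r}\}$. Then $G$ is analytic on $U$, maps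 $U$ into $\{|z|<\frac1{3r}\}$, and is injective on $U$; moreover $V\setminus\{0\}\subseteq G(U)$, while $0\notin G(U)$ and $G(z)\to0$ as $z\to\infty$ (so that $0$ corresponds to $z=\infty$). Hence $G$ has an inverse $K:V\setminus\{0\}\to U$. The function $K$ has a simple pole at $0$ and is of the form $K(z)=\frac1z+R(z)$ on $V\setminus\{0\}$ for an analytic function $R=R_\mu:V\to\mathbb C$. We have $$G\bigl(R(z)+\tfrac1z\bigr)=z\quad\text{if }0<|z|<\tfrac1{6r},\qquad R(G(z))+\tfrac1{G(z)}=z\quad\text{if }|z|>7r,$$ where in the second identity $G(z)\in V\setminus\{0\}$. (2) For all $z$ with $|z|<\frac{1}{6r}$ the series $\sum_{n\ge1}\kappa_nz^{n-1}$ converges and $$R(z)=\sum_{n=1}^\infty\kappa_nz^{n-1}.$$ (3) Let $\mu,\nu$ be compactly supported probability measures on $\mathbb R$. Then $\mu\boxplus\nu$ is well defined (such $\mathcal A,\varphi,x,y$ and such a measure exist, and the measure depends only on $\mu$ and $\nu$), and $$R_{\mu\boxplus\nu}(z)=R_\mu(z)+R_\nu(z)\qquad\text{for all }z\in\mathbb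 C\text{ with }|z|\text{ sufficiently small}$$ (for any choice of admissible radii $r$ in the definitions of the three functions). -/

import Mathlib

open MeasureTheory Filter Topology

noncomputable section

namespace FreeProb

/-! ### Non-crossing partitions and free cumulants -/

/-- A partition `π` of a finite subset `S` of a totally ordered set is non-crossing if there are no
`p₁ < q₁ < p₂ < q₂` in `S` with `p₁, p₂` in one block and `q₁, q₂` in a different block. -/
def IsNonCrossing {α : Type*} [LinearOrder α] {S : Finset α} (π : Finpartition S) : Prop :=
  ∀ V ∈ π.parts, ∀ W ∈ π.parts, ∀ p₁ ∈ V, ∀ q₁ ∈ W, ∀ p₂ ∈ V, ∀ q₂ ∈ W,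
    p₁ < q₁ → q₁ < p₂ → p₂ < q₂ → V = W

/-- The set `NC(S)` of non-crossing partitions of `S`, partially ordered by refinement
(`π ≤ σ` if every block of `π` is contained in a block of `σ`). -/
abbrev NC {α : Type*} [LinearOrder α] (S : Finset α) : Type _ :=
  {π : Finpartition S // IsNonCrossing π}

instance instFintypeNC {α : Type*} [LinearOrder α] (S : Finset α) : Fintype (NC S) := by
  classical exact inferInstance

instance instLocallyFiniteOrderNC {α : Type*} [LinearOrder α] (S : Finset α) :
    LocallyFiniteOrder (NC S) := by
  classical exact Fintype.toLocallyFiniteOrder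

theorem isNonCrossing_top {α : Type*} [LinearOrder α] (S : Finset α) :
    IsNonCrossing (⊤ : Finpartition S) := by
  intro V hV W hW p₁ _ q₁ _ p₂ _ q₂ _ _ _ _
  have hV' := Finpartition.parts_top_subset S hV
  have hW' := Finpartition.parts_top_subset S hW
  rw [Finset.mem_singleton] at hV' hW'
  rw [hV', hW']

/-- The maximal element of `NC(S)`, the partition with the single block `S`. -/
def NC.one {α : Type*} [LinearOrder α] (S : Finset α) : NC S := ⟨⊤, isNonCrossing_top S⟩

/-- The multiplicative extension `m_π = ∏_{V ∈ π} m_{#V}` of a sequence to `NC(S)`. -/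
def multExt {α : Type*} [LinearOrder α] {S : Finset α} (m : ℕ → ℂ) (π : NC S) : ℂ :=
  ∏ V ∈ π.1.parts, m V.card

open scoped Classical in
/-- The free cumulants `κ_n = ∑_{π ∈ NC(n)} m_π μ(π, 1_n)` (`n ≥ 1`) corresponding to a moment
sequence `(m_n)`, where `NC(n) = NC({1, …, n})` and `μ` is the Möbius function of `NC(n)`. -/
def freeCumulant (m : ℕ → ℂ) (n : ℕ) : ℂ :=
  ∑ π : NC (Finset.Icc 1 n), multExt m π * IncidenceAlgebra.mu ℂ π (NC.one (Finset.Icc 1 n))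

/-- The `n`-th moment of a measure on `ℝ`. -/
def moment (μ : Measure ℝ) (n : ℕ) : ℂ := ((∫ t : ℝ, t ^ n ∂μ : ℝ) : ℂ)

/-! ### Freeness and free convolution -/

/-- `(A, φ)` is a `*`-probability space: `φ` is a unital and positive linear functional. -/
structure IsState {A : Type*} [Ring A] [StarRing A] [Algebra ℂ A] (φ : A →ₗ[ℂ] ℂ) : Prop where
  map_one : φ 1 = 1
  re_nonneg : ∀ a : A, 0 ≤ (φ (star a * a)).re
  im_eq_zero : ∀ a : A, (φ (star a * a)).im = 0

/-- Unital subalgebras `(B i)` are free with respect to `φ`: `φ(a₀ ⋯ a_k) = 0` whenever the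
`a_j ∈ B (i j)` are centred and neighbouring indices are different. -/
def IsFree {A : Type*} [Ring A] [Algebra ℂ A] {I : Type*} (φ : A →ₗ[ℂ] ℂ)
    (B : I → Subalgebra ℂ A) : Prop :=
  ∀ (k : ℕ) (i : Fin (k + 1) → I) (a : Fin (k + 1) → A),
    (∀ j, a j ∈ B (i j)) → (∀ j : Fin k, i j.castSucc ≠ i j.succ) → (∀ j, φ (a j) = 0) →
    φ (List.ofFn a).prod = 0

/-- Random variables are free if the unital subalgebras that they generate are free. -/
def IsFreeFamily {A : Type*} [Ring A] [Algebra ℂ A] {I : Type*} (φ : A →ₗ[ℂ] ℂ)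
    (a : I → A) : Prop :=
  IsFree φ (fun i => Algebra.adjoin ℂ {a i})

/-- `μ` is the analytic distribution of `x`: the compactly supported probability measure on `ℝ`
whose moments are those of `x`. -/
structure IsDistribution {A : Type*} [Ring A] [Algebra ℂ A] (φ : A →ₗ[ℂ] ℂ) (x : A)
    (μ : Measure ℝ) : Prop where
  isProbabilityMeasure : IsProbabilityMeasure μ
  compact_support : ∃ M : ℝ, 0 < M ∧ μ (Set.Icc (-M) M) = 1
  moments : ∀ n : ℕ, φ (x ^ n) = moment μ n

/-- `ρ` is the distribution of `x + y` for some self-adjoint variables `x, y` with distributions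
`μ, ν` that are free in some `*`-probability space. -/
def IsFreeConvolution (μ ν ρ : Measure ℝ) : Prop :=
  ∃ (A : Type) (_ : Ring A) (_ : StarRing A) (_ : Algebra ℂ A) (_ : StarModule ℂ A)
    (φ : A →ₗ[ℂ] ℂ) (x y : A),
    IsState φ ∧ IsSelfAdjoint x ∧ IsSelfAdjoint y ∧
    IsDistribution φ x μ ∧ IsDistribution φ y ν ∧ IsFreeFamily φ ![x, y] ∧
    IsDistribution φ (x + y) ρ

/-- The free convolution `μ ⊞ ν`. -/
def freeConvolution (μ ν : Measure ℝ) : Measure ℝ :=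
  Classical.epsilon (IsFreeConvolution μ ν)

/-! ### The Cauchy transform and the `R`-transform -/

/-- The Cauchy transform `G_μ(z) = ∫ 1 / (z - t) dμ(t)`. -/
def cauchyTransform (μ : Measure ℝ) (z : ℂ) : ℂ := ∫ t : ℝ, 1 / (z - (t : ℂ)) ∂μ

/-- The domain `U = {z : |z| > 4r}`. -/
def domU (r : ℝ) : Set ℂ := {z | 4 * r < ‖z‖}

/-- The domain `V = {z : |z| < 1/(6r)}`. -/
def domV (r : ℝ) : Set ℂ := {z | ‖z‖ < 1 / (6 * r)}

/-- The inverse `K` of the Cauchy transform restricted to `U`. -/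
def kTransform (μ : Measure ℝ) (r : ℝ) : ℂ → ℂ :=
  Function.invFunOn (cauchyTransform μ) (domU r)

/-- The `R`-transform `R(z) = K(z) - 1/z`, with its singularity at `0` removed. -/
def rTransform (μ : Measure ℝ) (r : ℝ) : ℂ → ℂ :=
  Function.update (fun z => kTransform μ r z - 1 / z) 0
    (limUnder (𝓝[≠] (0 : ℂ)) (fun z => kTransform μ r z - 1 / z))

end FreeProb

end

open FreeProb

/-!
Throughout, `h_n(ζ) = ∫ t ^ n / (1 - t ζ) dμ(t)` (`momentGen`), so that `h_n(ζ) = m_n + ζ h_{n+1}(ζ)`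
and `G(1/ζ) = ζ h₀(ζ)` (`cauchyInv`).

*The inverse of the Cauchy transform.* For `|ζ| < 1/(4r)` the integrand of `h₀` is within `1/3` of
`1`. Hence `ζ ↦ ζ h₀(ζ)` stretches distances by at least `2/9` (`le_norm_cauchyInv_sub`), so that it
is injective with an analytic inverse `g`, and `ζ ↦ w / h₀(ζ)` is a contraction for `|w| < 1/(6r)`,
so that `w` is in its range (`exists_cauchyInv_eq`). Then `K = 1/g`, and `R = h₁(g) / h₀(g)`
(`rTransform_eq`) is analytic at `0` as well.

*The coefficients of `R` are the free cumulants.* By Möbius inversion, a sequence `c` with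
`m_n = ∑_{π ∈ NC(n)} ∏_{V ∈ π} c_{#V}` is that of the free cumulants (`freeCumulant_eq_of_ncSum`).
A non-crossing partition is decomposed by the element `b` that follows the smallest element `a` in
its block: the elements strictly between `a` and `b` are partitioned independently of the others,
and removing `a` shortens the first block of the rest (`ncSum_insert`). In terms of generating
functions this is a recursion (`ncSum_eq_coeff`) that holds for the series of
`h₀(ζ) R_k(ζ h₀(ζ))`, where `R_k` is the `k`-fold difference quotient of `R` at `0`
(`hasSum_rTransform`).

*Additivity.* Put `κ = w K(w) = 1 + w R(w)`. The identity `G(K(w)) = w` can be read as a relation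
between the formal power series `κ` and the moments (`InvertsMoments`), in which each of the two
determines the other. For a random variable `x` it says that the resolvent `(κ_x - w x)⁻¹` is
`1 - E_x` with `φ(E_x) = 0`. If `x` and `y` are free, the factorization
`(κ_x + κ_y - 1 - w (x + y))⁻¹ = (1 - E_y) (1 - E_x E_y)⁻¹ (1 - E_x)` expands into `1` plus
alternating products of centred elements, so that `κ_x + κ_y - 1` is the series of `x + y`
(`InvertsMoments.add_of_free`). This gives both the uniqueness of the free convolution and
`R_{μ ⊞ ν} = R_μ + R_ν`.

*Existence.* Multiplication by the variable on `L²(μ)` is, in an orthonormal basis that contains the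
constant function `1`, an operator on a pointed space `ℓ²(N)` with distribution `μ`
(`exists_operator_model`). The free product of two pointed spaces `ℓ²(N₀)`, `ℓ²(N₁)` is `ℓ²` of the
set of reduced words. The operators of each factor act on the first letter, and these two actions
are free in the state of the empty word (`isFree_range_freeAction`). The sum of the two operators is
bounded and self-adjoint; the Riesz–Markov–Kakutani theorem on its spectrum provides its
distribution (`exists_isDistribution`).
-/

noncomputable section

namespace FreeProb

/-! ### Sums over non-crossing partitions -/

/-- The sum over all non-crossing partitions of `S` of the product of the weights of the blocks. -/
def ncSum (w : Finset ℕ → ℂ) (S : Finset ℕ) : ℂ := ∑ π : NC S, ∏ V ∈ π.1.parts, w V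

theorem ncSum_congr {w w' : Finset ℕ → ℂ} {S : Finset ℕ} (h : ∀ V, V ⊆ S → w V = w' V) :
    ncSum w S = ncSum w' S :=
  Finset.sum_congr rfl fun π _ => Finset.prod_congr rfl fun _ hV => h _ (π.1.subset hV)

theorem ncSum_empty (w : Finset ℕ → ℂ) : ncSum w ∅ = 1 := by
  have h : ∀ π : NC (∅ : Finset ℕ), ∏ V ∈ π.1.parts, w V = 1 := fun π => by
    have : π.1.parts = ∅ := π.1.parts_eq_empty_iff.2 rfl
    rw [this, Finset.prod_empty]
  have hu : ∀ π : NC (∅ : Finset ℕ), π = NC.one ∅ := fun π =>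
    Subtype.ext (@Subsingleton.elim _ (inferInstanceAs (Subsingleton (Finpartition (⊥ : Finset ℕ)))) _ _)
  rw [ncSum, Finset.sum_congr rfl fun π _ => h π, Finset.sum_const, nsmul_one]
  have : (Finset.univ : Finset (NC (∅ : Finset ℕ))) = {NC.one ∅} := by
    ext π; simp [hu π]
  rw [this]; simp

theorem finpartition_eq_of_parts_subset {S : Finset ℕ} {π σ : Finpartition S}
    (h : π.parts ⊆ σ.parts) : π = σ := by
  refine Finpartition.ext (h.antisymm fun W hW => ?_)
  obtain ⟨x, hx⟩ := σ.nonempty_of_mem_parts hW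
  obtain ⟨V, hV, hxV⟩ := π.exists_mem (σ.subset hW hx)
  rwa [σ.eq_of_mem_parts hW (h hV) hx hxV]

/-- The blocks of `σ` inside a block `V` of a coarser partition `π`. -/
def partsWithin {S : Finset ℕ} {σ π : Finpartition S} (h : σ ≤ π) {V : Finset ℕ}
    (hV : V ∈ π.parts) : Finpartition V :=
  Finpartition.ofExistsUnique (σ.parts.filter (· ⊆ V)) (fun _ hp => (Finset.mem_filter.1 hp).2)
    (fun a ha => by
      obtain ⟨W, ⟨hW, haW⟩, hu⟩ := σ.existsUnique_mem (π.subset hV ha)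
      refine ⟨W, ⟨Finset.mem_filter.2 ⟨hW, ?_⟩, haW⟩,
        fun W' hW' => hu W' ⟨(Finset.mem_filter.1 hW'.1).1, hW'.2⟩⟩
      obtain ⟨V', hV', hWV'⟩ := h hW
      rwa [π.eq_of_mem_parts hV hV' ha (hWV' haW)])
    (fun h => σ.empty_notMem_parts (Finset.mem_filter.1 h).1)

theorem mem_parts_partsWithin {S : Finset ℕ} {σ π : Finpartition S} (h : σ ≤ π) {V : Finset ℕ}
    (hV : V ∈ π.parts) {W : Finset ℕ} :
    W ∈ (partsWithin h hV).parts ↔ W ∈ σ.parts ∧ W ⊆ V := Finset.mem_filter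

/-- The lower set of `π` in `NC(S)` is the product of the sets `NC(V)` over the blocks `V` of `π`,
so that sums over it factorize. -/
theorem sum_le_eq_prod_ncSum (w : Finset ℕ → ℂ) {S : Finset ℕ} (π : NC S)
    [DecidablePred (· ≤ π)] :
    ∑ σ : NC S with σ ≤ π, ∏ V ∈ σ.1.parts, w V = ∏ V ∈ π.1.parts, ncSum w V := by
  classical
  simp only [ncSum]
  rw [Finset.prod_sum]
  have hle : ∀ p : (V : Finset ℕ) → V ∈ π.1.parts → NC V,
      π.1.bind (fun V hV => (p V hV).1) ≤ π.1 := by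
    intro p W hW
    obtain ⟨V, hV, hWV⟩ := Finpartition.mem_bind.1 hW
    exact ⟨V, hV, (p V hV).1.subset hWV⟩
  refine (Finset.sum_bij' (fun p _ => (⟨π.1.bind fun V hV => (p V hV).1, ?_⟩ : NC S))
    (fun σ hσ V hV => (⟨partsWithin (Finset.mem_filter.1 hσ).2 hV, ?_⟩ : NC V))
    ?_ ?_ ?_ ?_ ?_).symm
  · intro A hA B hB p₁ hp₁ q₁ hq₁ p₂ hp₂ q₂ hq₂ h₁ h₂ h₃
    obtain ⟨V, hV, hAV⟩ := Finpartition.mem_bind.1 hA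
    obtain ⟨W, hW, hBW⟩ := Finpartition.mem_bind.1 hB
    have hAs := (p V hV).1.subset hAV
    have hBs := (p W hW).1.subset hBW
    obtain rfl := π.2 V hV W hW p₁ (hAs hp₁) q₁ (hBs hq₁) p₂ (hAs hp₂) q₂ (hBs hq₂) h₁ h₂ h₃
    exact (p V hV).2 A hAV B hBW p₁ hp₁ q₁ hq₁ p₂ hp₂ q₂ hq₂ h₁ h₂ h₃
  · intro A hA B hB
    exact σ.2 A ((mem_parts_partsWithin _ _).1 hA).1 B ((mem_parts_partsWithin _ _).1 hB).1
  · intro p _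
    exact Finset.mem_filter.2 ⟨Finset.mem_univ _, hle p⟩
  · intro σ _
    exact Finset.mem_pi.2 fun _ _ => Finset.mem_univ _
  · intro p _
    funext V hV
    refine Subtype.ext (finpartition_eq_of_parts_subset fun W hW => ?_).symm
    rw [mem_parts_partsWithin]
    exact ⟨Finpartition.mem_bind.2 ⟨V, hV, hW⟩, (p V hV).1.subset hW⟩
  · intro σ hσ
    refine Subtype.ext (finpartition_eq_of_parts_subset fun W hW => ?_).symm
    obtain ⟨V, hV, hWV⟩ := (Finset.mem_filter.1 hσ).2 hW
    exact Finpartition.mem_bind.2 ⟨V, hV, (mem_parts_partsWithin _ _).2 ⟨hW, hWV⟩⟩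
  · intro p _
    have hparts : (π.1.bind fun V hV => (p V hV).1).parts
        = π.1.parts.attach.biUnion fun V => (p V.1 V.2).1.parts := rfl
    rw [hparts, Finset.prod_biUnion]
    intro V _ W _ hVW
    refine Finset.disjoint_left.2 fun A hA hA' => hVW (Subtype.ext ?_)
    obtain ⟨x, hx⟩ := (p V.1 V.2).1.nonempty_of_mem_parts hA
    exact π.1.eq_of_mem_parts V.2 W.2 ((p V.1 V.2).1.subset hA hx) ((p W.1 W.2).1.subset hA' hx)

/-- If the sequence `c` satisfies the moment-cumulant formula
`m_n = ∑_{π ∈ NC(n)} ∏_{V ∈ π} c_{#V}`, then Möbius inversion gives `c_n = κ_n`. -/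
theorem freeCumulant_eq_of_ncSum {m c : ℕ → ℂ}
    (h : ∀ S : Finset ℕ, ncSum (fun V => c V.card) S = m S.card) {n : ℕ} (hn : 0 < n) :
    freeCumulant m n = c n := by
  classical
  have hS : (Finset.Icc 1 n).Nonempty := ⟨1, by simp; omega⟩
  have htop : ∀ σ : NC (Finset.Icc 1 n), σ ≤ NC.one _ := fun σ => (le_top : σ.1 ≤ ⊤)
  have h1 : ∀ π : NC (Finset.Icc 1 n), multExt m π
      = ∑ σ : NC (Finset.Icc 1 n), if σ ≤ π then ∏ V ∈ σ.1.parts, c V.card else 0 := by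
    intro π
    rw [multExt, ← Finset.sum_filter, sum_le_eq_prod_ncSum]
    exact Finset.prod_congr rfl fun V _ => (h V).symm
  have h2 : ∀ σ : NC (Finset.Icc 1 n), ∑ π : NC (Finset.Icc 1 n),
      (if σ ≤ π then IncidenceAlgebra.mu ℂ π (NC.one _) else 0)
        = if σ = NC.one _ then 1 else 0 := by
    intro σ
    rw [← IncidenceAlgebra.sum_Icc_mu_left, ← Finset.sum_filter]
    refine Finset.sum_congr ?_ fun _ _ => rfl
    ext π
    simp [htop π]
  have h3 : (NC.one (Finset.Icc 1 n)).1.parts = {Finset.Icc 1 n} := by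
    refine Finset.Subset.antisymm (Finpartition.parts_top_subset _) ?_
    obtain ⟨V, hV⟩ := (NC.one (Finset.Icc 1 n)).1.parts_nonempty hS.ne_empty
    have := Finset.mem_singleton.1 (Finpartition.parts_top_subset _ hV)
    exact Finset.singleton_subset_iff.2 (this ▸ hV)
  rw [freeCumulant]
  simp_rw [h1, Finset.sum_mul]
  rw [Finset.sum_comm]
  calc _ = ∑ σ : NC (Finset.Icc 1 n), (∏ V ∈ σ.1.parts, c V.card) *
        (if σ = NC.one _ then 1 else 0) := by
        refine Finset.sum_congr rfl fun σ _ => ?_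
        rw [← h2, Finset.mul_sum]
        refine Finset.sum_congr rfl fun π _ => ?_
        split_ifs <;> simp
    _ = c n := by simp [h3]

/-- The non-crossing partitions of `S` without a block on both sides of the cut before `b` form the
lower set of the partition into the elements below `b` and the others, so that the sum over them
factorizes. -/
theorem ncSum_split (w : Finset ℕ → ℂ) {S : Finset ℕ} {b : ℕ} (hb : b ∈ S) :
    ∑ σ : NC S with ∀ V ∈ σ.1.parts, (∀ x ∈ V, x < b) ∨ ∀ x ∈ V, b ≤ x, ∏ V ∈ σ.1.parts, w V
      = ncSum w (S.filter (· < b)) * ncSum w (S.filter (b ≤ ·)) := by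
  classical
  set L := S.filter (· < b) with hL
  set R := S.filter (b ≤ ·) with hR
  have hbR : b ∈ R := Finset.mem_filter.2 ⟨hb, le_rfl⟩
  have hbL : b ∉ L := fun h => absurd (Finset.mem_filter.1 h).2 (lt_irrefl b)
  have hne : L ≠ R := fun h => hbL (h ▸ hbR)
  let π₀ : Finpartition S := Finpartition.ofExistsUnique (({L, R} : Finset (Finset ℕ)).erase ∅)
    (by
      intro p hp
      have := Finset.mem_of_mem_erase hp
      simp only [Finset.mem_insert, Finset.mem_singleton] at this
      rcases this with rfl | rfl <;> exact Finset.filter_subset _ _)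
    (by
      intro x hx
      rcases lt_or_ge x b with h | h
      · have hxL : x ∈ L := Finset.mem_filter.2 ⟨hx, h⟩
        refine ⟨L, ⟨Finset.mem_erase.2 ⟨Finset.ne_empty_of_mem hxL, by simp⟩, hxL⟩, ?_⟩
        rintro W ⟨hW, hxW⟩
        have := Finset.mem_of_mem_erase hW
        simp only [Finset.mem_insert, Finset.mem_singleton] at this
        rcases this with rfl | rfl
        · rfl
        · exact absurd (Finset.mem_filter.1 hxW).2 (not_le.2 h)
      · have hxR : x ∈ R := Finset.mem_filter.2 ⟨hx, h⟩
        refine ⟨R, ⟨Finset.mem_erase.2 ⟨Finset.ne_empty_of_mem hxR, by simp⟩, hxR⟩, ?_⟩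
        rintro W ⟨hW, hxW⟩
        have := Finset.mem_of_mem_erase hW
        simp only [Finset.mem_insert, Finset.mem_singleton] at this
        rcases this with rfl | rfl
        · exact absurd (Finset.mem_filter.1 hxW).2 (not_lt.2 h)
        · rfl)
    (by simp)
  have hmem : ∀ V ∈ π₀.parts, V = L ∨ V = R := by
    intro V hV
    have := Finset.mem_of_mem_erase (show V ∈ ({L, R} : Finset (Finset ℕ)).erase ∅ from hV)
    simpa using this
  have hnc : IsNonCrossing π₀ := by
    intro V hV W hW p₁ hp₁ q₁ hq₁ p₂ hp₂ q₂ hq₂ h₁ h₂ h₃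
    rcases hmem V hV with rfl | rfl <;> rcases hmem W hW with rfl | rfl
    · rfl
    · have h4 := (Finset.mem_filter.1 hp₂).2
      have h5 := (Finset.mem_filter.1 hq₁).2
      omega
    · have h4 := (Finset.mem_filter.1 hp₁).2
      have h5 := (Finset.mem_filter.1 hq₁).2
      omega
    · rfl
  have key := sum_le_eq_prod_ncSum w ⟨π₀, hnc⟩
  have hprod : ∏ V ∈ π₀.parts, ncSum w V = ncSum w L * ncSum w R := by
    rw [← Finset.prod_pair hne]
    exact Finset.prod_erase _ (ncSum_empty w)
  rw [hprod] at key
  rw [← key]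
  refine Finset.sum_congr (Finset.filter_congr fun σ _ => ?_) fun _ _ => rfl
  constructor
  · intro h V hV
    obtain ⟨x, hx⟩ := σ.1.nonempty_of_mem_parts hV
    rcases h V hV with h | h
    · have hs : V ⊆ L := fun y hy => Finset.mem_filter.2 ⟨σ.1.subset hV hy, h y hy⟩
      exact ⟨L, Finset.mem_erase.2 ⟨Finset.ne_empty_of_mem (hs hx), by simp⟩, hs⟩
    · have hs : V ⊆ R := fun y hy => Finset.mem_filter.2 ⟨σ.1.subset hV hy, h y hy⟩
      exact ⟨R, Finset.mem_erase.2 ⟨Finset.ne_empty_of_mem (hs hx), by simp⟩, hs⟩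
  · intro h V hV
    obtain ⟨W, hW, hVW⟩ := h hV
    rcases hmem W hW with rfl | rfl
    · exact Or.inl fun x hx => (Finset.mem_filter.1 (hVW hx)).2
    · exact Or.inr fun x hx => (Finset.mem_filter.1 (hVW hx)).2

/-! ### The recursion for sums over non-crossing partitions -/

/-- The partition of `S` obtained from a partition of `S ∪ {a}` by deleting `a`. -/
def deletePoint {S : Finset ℕ} {a : ℕ} (ha : a ∉ S) (π : Finpartition (insert a S)) :
    Finpartition S :=
  (π.avoid {a}).copy (by
    rw [Finset.insert_sdiff_of_mem _ (Finset.mem_singleton_self a), Finset.sdiff_singleton_eq_erase,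
      Finset.erase_eq_of_notMem ha])

theorem mem_deletePoint {S : Finset ℕ} {a : ℕ} (ha : a ∉ S) (π : Finpartition (insert a S))
    {V : Finset ℕ} :
    V ∈ (deletePoint ha π).parts ↔ V.Nonempty ∧ ∃ W ∈ π.parts, W.erase a = V := by
  change V ∈ (π.avoid {a}).parts ↔ _
  rw [Finpartition.mem_avoid]
  constructor
  · rintro ⟨W, hW, h1, h2⟩
    rw [Finset.sdiff_singleton_eq_erase] at h2
    refine ⟨?_, W, hW, h2⟩
    rw [← h2, Finset.nonempty_iff_ne_empty, Ne, Finset.erase_eq_empty_iff]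
    rintro (h | h)
    · exact π.ne_empty hW h
    · exact h1 h.le
  · rintro ⟨hne, W, hW, h⟩
    refine ⟨W, hW, fun hle => ?_, by rw [Finset.sdiff_singleton_eq_erase, h]⟩
    rw [← h] at hne
    obtain ⟨x, hx⟩ := hne
    exact (Finset.mem_erase.1 hx).1 (Finset.mem_singleton.1 (hle (Finset.mem_of_mem_erase hx)))

theorem isNonCrossing_deletePoint {S : Finset ℕ} {a : ℕ} (ha : a ∉ S)
    {π : Finpartition (insert a S)} (hπ : IsNonCrossing π) :
    IsNonCrossing (deletePoint ha π) := by
  intro V hV W hW p₁ hp₁ q₁ hq₁ p₂ hp₂ q₂ hq₂ h₁ h₂ h₃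
  obtain ⟨-, V', hV', rfl⟩ := (mem_deletePoint ha π).1 hV
  obtain ⟨-, W', hW', rfl⟩ := (mem_deletePoint ha π).1 hW
  rw [hπ V' hV' W' hW' p₁ (Finset.mem_of_mem_erase hp₁) q₁ (Finset.mem_of_mem_erase hq₁)
    p₂ (Finset.mem_of_mem_erase hp₂) q₂ (Finset.mem_of_mem_erase hq₂) h₁ h₂ h₃]

/-- The partition of `S ∪ {a}` obtained by adding the block `{a}`. -/
def addSingleton {S : Finset ℕ} {a : ℕ} (ha : a ∉ S) (σ : Finpartition S) :
    Finpartition (insert a S) :=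
  σ.extend (b := {a}) (Finset.singleton_ne_empty a) (Finset.disjoint_singleton_right.2 ha)
    (by rw [Finset.sup_eq_union, Finset.union_comm, Finset.insert_eq])

/-- The contribution of the partitions in which the smallest element `a` is a block. -/
theorem sum_singleton_block (w : Finset ℕ → ℂ) {S : Finset ℕ} {a : ℕ} (hS : ∀ x ∈ S, a < x) :
    ∑ π : NC (insert a S) with {a} ∈ π.1.parts, ∏ V ∈ π.1.parts, w V = w {a} * ncSum w S := by
  classical
  have ha : a ∉ S := fun h => lt_irrefl a (hS a h)
  have hp : ∀ σ : Finpartition S, (addSingleton ha σ).parts = insert {a} σ.parts := fun _ => rfl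
  have hn : ∀ (σ : Finpartition S) (V), V ∈ σ.parts → a ∉ V := fun σ V hV h => ha (σ.subset hV h)
  rw [ncSum, Finset.mul_sum]
  refine (Finset.sum_bij' (fun σ _ => (⟨addSingleton ha σ.1, ?_⟩ : NC (insert a S)))
    (fun π _ => (⟨deletePoint ha π.1, isNonCrossing_deletePoint ha π.2⟩ : NC S))
    ?_ ?_ ?_ ?_ ?_).symm
  · intro V hV W hW p₁ hp₁ q₁ hq₁ p₂ hp₂ q₂ hq₂ h₁ h₂ h₃
    rw [hp, Finset.mem_insert] at hV hW
    rcases hV with rfl | hV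
    · rw [Finset.mem_singleton] at hp₁ hp₂
      omega
    · rcases hW with rfl | hW
      · rw [Finset.mem_singleton] at hq₁ hq₂
        omega
      · exact σ.2 V hV W hW p₁ hp₁ q₁ hq₁ p₂ hp₂ q₂ hq₂ h₁ h₂ h₃
  · intro σ _
    simp [hp]
  · intro π _
    simp
  · intro σ _
    refine Subtype.ext (finpartition_eq_of_parts_subset fun V hV => ?_).symm
    rw [mem_deletePoint]
    refine ⟨σ.1.nonempty_of_mem_parts hV, V, ?_, Finset.erase_eq_of_notMem (hn σ.1 V hV)⟩
    exact Finset.mem_insert_of_mem hV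
  · intro π hπ
    have hπ' := (Finset.mem_filter.1 hπ).2
    refine Subtype.ext (finpartition_eq_of_parts_subset fun V hV => ?_).symm
    change V ∈ insert {a} (deletePoint ha π.1).parts
    rw [Finset.mem_insert]
    by_cases hV' : a ∈ V
    · exact Or.inl (π.1.eq_of_mem_parts hV hπ' hV' (Finset.mem_singleton_self a))
    · exact Or.inr ((mem_deletePoint ha π.1).2
        ⟨π.1.nonempty_of_mem_parts hV, V, hV, Finset.erase_eq_of_notMem hV'⟩)
  · intro σ _
    change _ = ∏ V ∈ insert {a} σ.1.parts, w V
    rw [Finset.prod_insert fun h => hn σ.1 _ h (Finset.mem_singleton_self a)]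

/-- Add `a` to `V` if `b` is in `V`. -/
def insertWith (a b : ℕ) (V : Finset ℕ) : Finset ℕ := if b ∈ V then insert a V else V

theorem mem_insertWith {a b : ℕ} {V : Finset ℕ} {x : ℕ} :
    x ∈ insertWith a b V ↔ x ∈ V ∨ (x = a ∧ b ∈ V) := by
  unfold insertWith
  split_ifs with h
  · simp [h, or_comm]
  · simp [h]

theorem erase_insertWith {a b : ℕ} {V : Finset ℕ} (h : a ∉ V) :
    (insertWith a b V).erase a = V := by
  ext x
  rw [Finset.mem_erase, mem_insertWith]
  constructor
  · rintro ⟨h1, h2 | h2⟩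
    · exact h2
    · exact absurd h2.1 h1
  · intro hx
    exact ⟨fun h' => h (h' ▸ hx), Or.inl hx⟩

/-- The partition of `S ∪ {a}` obtained by adding `a` to the block of `b`. -/
def addToBlock {S : Finset ℕ} (a : ℕ) {b : ℕ} (ha : a ∉ S) (hb : b ∈ S) (σ : Finpartition S) :
    Finpartition (insert a S) :=
  Finpartition.ofExistsUnique (σ.parts.image (insertWith a b))
    (by
      intro p hp x hx
      obtain ⟨V, hV, rfl⟩ := Finset.mem_image.1 hp
      rcases mem_insertWith.1 hx with h | h
      · exact Finset.mem_insert_of_mem (σ.subset hV h)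
      · rw [h.1]; exact Finset.mem_insert_self _ _)
    (by
      intro x hx
      have key : ∀ y ∈ S, (∀ V, V ∈ σ.parts → (x ∈ insertWith a b V ↔ y ∈ V)) →
          ∃! t, t ∈ σ.parts.image (insertWith a b) ∧ x ∈ t := by
        intro y hy h
        obtain ⟨V, ⟨hV, hyV⟩, hu⟩ := σ.existsUnique_mem hy
        refine ⟨insertWith a b V, ⟨Finset.mem_image_of_mem _ hV, (h V hV).2 hyV⟩, ?_⟩
        rintro _ ⟨ht, hxt⟩
        obtain ⟨W, hW, rfl⟩ := Finset.mem_image.1 ht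
        rw [hu W ⟨hW, (h W hW).1 hxt⟩]
      rcases Finset.mem_insert.1 hx with rfl | hxS
      · refine key b hb fun V hV => ?_
        rw [mem_insertWith]
        exact ⟨fun h => h.elim (fun h => absurd (σ.subset hV h) ha) (·.2), fun h => Or.inr ⟨rfl, h⟩⟩
      · refine key x hxS fun V hV => ?_
        rw [mem_insertWith]
        exact ⟨fun h => h.elim id (fun h => absurd (h.1 ▸ hxS) ha), Or.inl⟩)
    (by
      intro h
      obtain ⟨V, hV, h⟩ := Finset.mem_image.1 h
      obtain ⟨x, hx⟩ := σ.nonempty_of_mem_parts hV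
      exact Finset.notMem_empty x (h ▸ mem_insertWith.2 (Or.inl hx)))

theorem mem_addToBlock {S : Finset ℕ} {a b : ℕ} (ha : a ∉ S) (hb : b ∈ S) (σ : Finpartition S)
    {V : Finset ℕ} :
    V ∈ (addToBlock a ha hb σ).parts ↔ ∃ W ∈ σ.parts, insertWith a b W = V := Finset.mem_image

/-- Non-crossing partitions of `S ∪ {a}`, with `a < min S`, in which `b` follows `a` in its block
correspond to non-crossing partitions of `S` with no block on both sides of the cut before `b`. -/
theorem sum_next_eq (w : Finset ℕ → ℂ) {S : Finset ℕ} {a b : ℕ} (hS : ∀ x ∈ S, a < x)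
    (hb : b ∈ S) :
    ∑ π : NC (insert a S) with ∃ V ∈ π.1.parts, a ∈ V ∧ b ∈ V ∧ ∀ x ∈ V, x ≠ a → b ≤ x,
        ∏ V ∈ π.1.parts, w V
      = ∑ σ : NC S with ∀ V ∈ σ.1.parts, (∀ x ∈ V, x < b) ∨ ∀ x ∈ V, b ≤ x,
        ∏ V ∈ σ.1.parts, w (insertWith a b V) := by
  classical
  have ha : a ∉ S := fun h => lt_irrefl a (hS a h)
  have hab : a < b := hS b hb
  have hn : ∀ (σ : Finpartition S) (V), V ∈ σ.parts → a ∉ V := fun σ V hV h => ha (σ.subset hV h)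
  refine (Finset.sum_bij' (fun σ hσ => (⟨addToBlock a ha hb σ.1, ?_⟩ : NC (insert a S)))
    (fun π _ => (⟨deletePoint ha π.1, isNonCrossing_deletePoint ha π.2⟩ : NC S))
    ?_ ?_ ?_ ?_ ?_).symm
  · have hcut := (Finset.mem_filter.1 hσ).2
    intro V' hV' W' hW' p₁ hp₁ q₁ hq₁ p₂ hp₂ q₂ hq₂ h₁ h₂ h₃
    obtain ⟨V, hV, rfl⟩ := (mem_addToBlock ha hb σ.1).1 hV'
    obtain ⟨W, hW, rfl⟩ := (mem_addToBlock ha hb σ.1).1 hW'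
    congr 1
    have hge : a ≤ p₁ := by
      rcases mem_insertWith.1 hp₁ with h | h
      · exact (hS _ (σ.1.subset hV h)).le
      · exact h.1.ge
    have hq₁' := (mem_insertWith.1 hq₁).resolve_right fun h => by omega
    have hp₂' := (mem_insertWith.1 hp₂).resolve_right fun h => by omega
    have hq₂' := (mem_insertWith.1 hq₂).resolve_right fun h => by omega
    rcases mem_insertWith.1 hp₁ with hp₁' | ⟨-, hbV⟩
    · exact σ.2 V hV W hW p₁ hp₁' q₁ hq₁' p₂ hp₂' q₂ hq₂' h₁ h₂ h₃
    · have hVge : ∀ x ∈ V, b ≤ x :=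
        (hcut V hV).resolve_left fun h => lt_irrefl b (h b hbV)
      have hp₂b := hVge p₂ hp₂'
      rcases hcut W hW with h | h
      · have := h q₂ hq₂'
        omega
      · rcases (h q₁ hq₁').eq_or_lt with rfl | hlt
        · exact σ.1.eq_of_mem_parts hV hW hbV hq₁'
        · exact σ.2 V hV W hW b hbV q₁ hq₁' p₂ hp₂' q₂ hq₂' hlt h₂ h₃
  · intro σ hσ
    have hcut := (Finset.mem_filter.1 hσ).2
    refine Finset.mem_filter.2 ⟨Finset.mem_univ _, ?_⟩
    obtain ⟨V, hV, hbV⟩ := σ.1.exists_mem hb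
    refine ⟨insertWith a b V, (mem_addToBlock ha hb σ.1).2 ⟨V, hV, rfl⟩,
      mem_insertWith.2 (Or.inr ⟨rfl, hbV⟩), mem_insertWith.2 (Or.inl hbV), fun x hx hxa => ?_⟩
    exact (hcut V hV).resolve_left (fun h => lt_irrefl b (h b hbV)) x
      ((mem_insertWith.1 hx).resolve_right fun h => hxa h.1)
  · intro π hπ
    obtain ⟨V₀, hV₀, haV₀, hbV₀, hmin⟩ := (Finset.mem_filter.1 hπ).2
    refine Finset.mem_filter.2 ⟨Finset.mem_univ _, fun V hV => ?_⟩
    obtain ⟨-, W, hW, rfl⟩ := (mem_deletePoint ha π.1).1 hV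
    by_cases hWV : W = V₀
    · exact Or.inr fun x hx => hmin x (hWV ▸ Finset.mem_of_mem_erase hx) (Finset.mem_erase.1 hx).1
    · by_contra! hcon
      obtain ⟨⟨q, hq, hqb⟩, ⟨p, hp, hpb⟩⟩ := hcon
      have hbW : b ∉ W := fun h => hWV (π.1.eq_of_mem_parts hW hV₀ h hbV₀)
      have hq' := Finset.mem_of_mem_erase hq
      have hp' := Finset.mem_of_mem_erase hp
      have hap : a < p := hS p
        ((Finset.mem_insert.1 (π.1.subset hW hp')).resolve_left (Finset.mem_erase.1 hp).1)
      have hbq : b < q := lt_of_le_of_ne hqb fun h => hbW (h ▸ hq')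
      exact hWV (π.2 V₀ hV₀ W hW a haV₀ p hp' b hbV₀ q hq' hap hpb hbq).symm
  · intro σ _
    refine Subtype.ext (finpartition_eq_of_parts_subset fun V hV => ?_).symm
    exact (mem_deletePoint ha _).2 ⟨σ.1.nonempty_of_mem_parts hV, insertWith a b V,
      (mem_addToBlock ha hb σ.1).2 ⟨V, hV, rfl⟩, erase_insertWith (hn σ.1 V hV)⟩
  · intro π hπ
    obtain ⟨V₀, hV₀, haV₀, hbV₀, hmin⟩ := (Finset.mem_filter.1 hπ).2
    refine Subtype.ext (finpartition_eq_of_parts_subset fun V hV => ?_).symm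
    refine (mem_addToBlock ha hb _).2 ⟨V.erase a, (mem_deletePoint ha π.1).2 ⟨?_, V, hV, rfl⟩, ?_⟩
    · by_cases hV' : a ∈ V
      · rw [π.1.eq_of_mem_parts hV hV₀ hV' haV₀]
        exact ⟨b, Finset.mem_erase.2 ⟨hab.ne', hbV₀⟩⟩
      · rw [Finset.erase_eq_of_notMem hV']
        exact π.1.nonempty_of_mem_parts hV
    · by_cases hV' : a ∈ V
      · have : V = V₀ := π.1.eq_of_mem_parts hV hV₀ hV' haV₀
        rw [insertWith, if_pos (Finset.mem_erase.2 ⟨hab.ne', this ▸ hbV₀⟩), Finset.insert_erase hV']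
      · rw [Finset.erase_eq_of_notMem hV', insertWith, if_neg]
        intro hbV
        exact hV' (π.1.eq_of_mem_parts hV hV₀ hbV hbV₀ ▸ haV₀)
  · intro σ _
    change _ = ∏ V ∈ σ.1.parts.image (insertWith a b), w V
    rw [Finset.prod_image]
    intro V hV W hW hVW
    rw [← erase_insertWith (b := b) (hn σ.1 V hV), hVW, erase_insertWith (hn σ.1 W hW)]

/-- Recursion for sums over non-crossing partitions: either the smallest element `a` is a block, or
the next element `b` of its block cuts the other elements into two independent parts. -/
theorem ncSum_insert (w : Finset ℕ → ℂ) {S : Finset ℕ} {a : ℕ} (hS : ∀ x ∈ S, a < x) :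
    ncSum w (insert a S) = w {a} * ncSum w S + ∑ b ∈ S, ncSum w (S.filter (· < b)) *
      ncSum (fun V => w (insertWith a b V)) (S.filter (b ≤ ·)) := by
  classical
  have h1 : ∀ b ∈ S, ncSum w (S.filter (· < b)) *
      ncSum (fun V => w (insertWith a b V)) (S.filter (b ≤ ·)) =
      ∑ π : NC (insert a S), if ∃ V ∈ π.1.parts, a ∈ V ∧ b ∈ V ∧ ∀ x ∈ V, x ≠ a → b ≤ x then
        ∏ V ∈ π.1.parts, w V else 0 := by
    intro b hb
    rw [← Finset.sum_filter, sum_next_eq w hS hb, ncSum_split _ hb]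
    congr 1
    refine ncSum_congr fun V hV => ?_
    rw [insertWith, if_neg fun h => lt_irrefl b (Finset.mem_filter.1 (hV h)).2]
  rw [Finset.sum_congr rfl h1, ← sum_singleton_block w hS, Finset.sum_comm, Finset.sum_filter,
    ← Finset.sum_add_distrib, ncSum]
  refine Finset.sum_congr rfl fun π _ => ?_
  obtain ⟨V₀, hV₀, haV₀⟩ := π.1.exists_mem (Finset.mem_insert_self a S)
  have hu : ∀ V ∈ π.1.parts, a ∈ V → V = V₀ := fun V hV h => π.1.eq_of_mem_parts hV hV₀ h haV₀
  by_cases hs : {a} ∈ π.1.parts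
  · have hV : V₀ = {a} := (hu _ hs (Finset.mem_singleton_self a)).symm
    rw [if_pos hs, Finset.sum_eq_zero, add_zero]
    intro b hb
    rw [if_neg]
    rintro ⟨V, hV', haV, hbV, -⟩
    rw [hu V hV' haV, hV, Finset.mem_singleton] at hbV
    exact absurd (hS b hb) (by omega)
  · have hne : (V₀.erase a).Nonempty := by
      rw [Finset.nonempty_iff_ne_empty, Ne, Finset.erase_eq_empty_iff]
      rintro (h | h)
      · exact π.1.ne_empty hV₀ h
      · exact hs (h ▸ hV₀)
    have hmem := Finset.min'_mem _ hne
    set b₀ := (V₀.erase a).min' hne with hb₀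
    have hb₀S : b₀ ∈ S := (Finset.mem_insert.1 (π.1.subset hV₀ (Finset.mem_of_mem_erase hmem))).resolve_left
      (Finset.mem_erase.1 hmem).1
    rw [if_neg hs, zero_add, Finset.sum_eq_single b₀]
    · rw [if_pos]
      exact ⟨V₀, hV₀, haV₀, Finset.mem_of_mem_erase hmem,
        fun x hx hxa => Finset.min'_le _ _ (Finset.mem_erase.2 ⟨hxa, hx⟩)⟩
    · intro b hb hbne
      rw [if_neg]
      rintro ⟨V, hV', haV, hbV, hmin⟩
      rw [hu V hV' haV] at hbV hmin
      refine hbne (le_antisymm (hmin _ (Finset.mem_of_mem_erase hmem) (Finset.mem_erase.1 hmem).1) ?_)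
      exact Finset.min'_le _ _ (Finset.mem_erase.2 ⟨(hS b hb).ne', hbV⟩)
    · exact fun h => absurd hb₀S h

theorem sum_card_filter_lt {M : Type*} [AddCommMonoid M] (f : ℕ → M) (S : Finset ℕ) :
    ∑ b ∈ S, f (S.filter (· < b)).card = ∑ i ∈ Finset.range S.card, f i := by
  induction S using Finset.induction_on_max with
  | empty => simp
  | insert m S hm ih =>
    have hmS : m ∉ S := fun h => lt_irrefl m (hm m h)
    rw [Finset.sum_insert hmS, Finset.card_insert_of_notMem hmS, Finset.sum_range_succ, ← ih,
      add_comm]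
    congr 1
    · refine Finset.sum_congr rfl fun b hb => ?_
      rw [Finset.filter_insert, if_neg (not_lt.2 (hm b hb).le)]
    · rw [Finset.filter_insert, if_neg (lt_irrefl m), Finset.filter_true_of_mem hm]

open PowerSeries in
/-- The moment-cumulant formula in terms of generating functions. If `M(X)` and `P_k(X)` satisfy
`M = 1 + X P_0` and `P_k = c_k M + X M P_{k+1}`, the coefficients of `M` are the sums over
non-crossing partitions with weights `c_{#V-1}`, and those of `P_k` are such sums in which the size
of the first block is increased by `k`. -/
theorem ncSum_eq_coeff {c : ℕ → ℂ} {M : PowerSeries ℂ} {P : ℕ → PowerSeries ℂ}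
    (hM : M = 1 + X * P 0) (hP : ∀ k, P k = C (c k) * M + X * (M * P (k + 1))) (N : ℕ) :
    (∀ S : Finset ℕ, S.card = N → ncSum (fun V => c (V.card - 1)) S = coeff N M) ∧
    ∀ k (S : Finset ℕ) (a : ℕ), (∀ x ∈ S, a < x) → S.card = N →
      ncSum (fun V => if a ∈ V then c (V.card - 1 + k) else c (V.card - 1)) (insert a S)
        = coeff N (P k) := by
  induction N using Nat.strong_induction_on with
  | _ N ih =>
    have h1 : ∀ S : Finset ℕ, S.card = N → ncSum (fun V => c (V.card - 1)) S = coeff N M := by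
      intro S hS
      rcases N with _ | N
      · rw [Finset.card_eq_zero.1 hS, ncSum_empty, hM]
        simp
      · have hne : S.Nonempty := Finset.card_pos.1 (by omega)
        have := (ih N (Nat.lt_succ_self N)).2 0 (S.erase (S.min' hne)) (S.min' hne)
          (fun x hx => Finset.min'_lt_of_mem_erase_min' S hne hx)
          (by rw [Finset.card_erase_of_mem (Finset.min'_mem S hne), hS]; rfl)
        rw [Finset.insert_erase (Finset.min'_mem S hne)] at this
        rw [hM]
        simp only [map_add, coeff_succ_X_mul, coeff_one, Nat.add_eq_zero_iff, one_ne_zero, and_false,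
          if_false, zero_add]
        rw [← this]
        refine ncSum_congr fun V _ => ?_
        simp
    refine ⟨h1, fun k S a hS hcard => ?_⟩
    have haS : a ∉ S := fun h => lt_irrefl a (hS a h)
    rw [ncSum_insert _ hS]
    have h2 : ∀ T, T ⊆ S → ncSum (fun V => if a ∈ V then c (V.card - 1 + k) else c (V.card - 1)) T
        = ncSum (fun V => c (V.card - 1)) T := fun T hT =>
      ncSum_congr fun V hV => if_neg fun h => haS (hT (hV h))
    have h3 : ∀ b ∈ S, ncSum (fun V => if a ∈ V then c (V.card - 1 + k) else c (V.card - 1))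
          (S.filter (· < b)) * ncSum (fun V => if a ∈ insertWith a b V then
            c ((insertWith a b V).card - 1 + k) else c ((insertWith a b V).card - 1))
              (S.filter (b ≤ ·))
        = (fun i => coeff i M * coeff (N - 1 - i) (P (k + 1))) (S.filter (· < b)).card := by
      intro b hb
      have hsum : (S.filter (· < b)).card + (S.filter (b ≤ ·)).card = N := by
        rw [← hcard, ← Finset.card_filter_add_card_filter_not (s := S) (· < b)]
        simp
      have hbm : b ∈ S.filter (b ≤ ·) := Finset.mem_filter.2 ⟨hb, le_rfl⟩
      have hpos : 0 < (S.filter (b ≤ ·)).card := Finset.card_pos.2 ⟨b, hbm⟩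
      rw [h2 _ (Finset.filter_subset _ _), (ih _ (by omega)).1 _ rfl]
      congr 1
      have h4 := (ih (N - 1 - (S.filter (· < b)).card) (by omega)).2 (k + 1)
        ((S.filter (b ≤ ·)).erase b) b (fun x hx => lt_of_le_of_ne
          (Finset.mem_filter.1 (Finset.mem_of_mem_erase hx)).2 (Finset.mem_erase.1 hx).1.symm)
        (by rw [Finset.card_erase_of_mem hbm]; omega)
      rw [Finset.insert_erase hbm] at h4
      rw [← h4]
      refine ncSum_congr fun V hV => ?_
      have haV : a ∉ V := fun h => haS (Finset.mem_filter.1 (hV h)).1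
      by_cases hbV : b ∈ V
      · have : 0 < V.card := Finset.card_pos.2 ⟨b, hbV⟩
        rw [insertWith, if_pos hbV, if_pos (Finset.mem_insert_self a V), if_pos hbV,
          Finset.card_insert_of_notMem haV]
        congr 1
        omega
      · rw [insertWith, if_neg hbV, if_neg haV, if_neg hbV]
    rw [h2 S subset_rfl, h1 S hcard, Finset.sum_congr rfl h3,
      sum_card_filter_lt (fun i => coeff i M * coeff (N - 1 - i) (P (k + 1))), hcard, hP k]
    simp only [Finset.mem_singleton, if_true, Finset.card_singleton, map_add, coeff_C_mul]
    congr 1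
    · simp
    · rcases N with _ | N
      · simp
      · rw [coeff_succ_X_mul, coeff_mul, Finset.Nat.sum_antidiagonal_eq_sum_range_succ_mk]
        rfl

/-- The generating function form of the moment-cumulant formula determines the free cumulants. -/
theorem freeCumulant_eq_of_powerSeries {m c : ℕ → ℂ} {P : ℕ → PowerSeries ℂ}
    (hM : PowerSeries.mk m = 1 + PowerSeries.X * P 0)
    (hP : ∀ k, P k = PowerSeries.C (c k) * PowerSeries.mk m
      + PowerSeries.X * (PowerSeries.mk m * P (k + 1))) (n : ℕ) :
    freeCumulant m (n + 1) = c n :=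
  freeCumulant_eq_of_ncSum (c := fun n => c (n - 1))
    (fun S => by
      rw [(ncSum_eq_coeff hM hP S.card).1 S rfl, PowerSeries.coeff_mk]) n.succ_pos

/-! ### The Cauchy transform at infinity -/

/-- The function `ζ ↦ ∫ t ^ n / (1 - t ζ) dμ(t)`. For `n = 0` it is the moment generating function
`M` of `μ`, and `G(z) = M(1 / z) / z`. -/
def momentGen (μ : Measure ℝ) (n : ℕ) (ζ : ℂ) : ℂ := ∫ t : ℝ, (t : ℂ) ^ n / (1 - t * ζ) ∂μ

/-- The function `ζ M(ζ) = G(1 / ζ)`. -/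
def cauchyInv (μ : Measure ℝ) (ζ : ℂ) : ℂ := ζ * momentGen μ 0 ζ

theorem ae_abs_le {μ : Measure ℝ} [IsProbabilityMeasure μ] {r : ℝ}
    (hμ : μ (Set.Icc (-r) r) = 1) : ∀ᵐ t ∂μ, |t| ≤ r := by
  have : ∀ᵐ t ∂μ, t ∈ Set.Icc (-r) r := (prob_compl_eq_zero_iff measurableSet_Icc).2 hμ
  exact this.mono fun t ht => abs_le.2 ht

theorem three_quarters_le {r t : ℝ} (hr : 0 < r) (ht : |t| ≤ r) {ζ : ℂ} (hζ : ‖ζ‖ < 1 / (4 * r)) :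
    3 / 4 ≤ ‖1 - (t : ℂ) * ζ‖ := by
  have h1 : ‖(t : ℂ) * ζ‖ ≤ 1 / 4 := by
    rw [norm_mul, Complex.norm_real, Real.norm_eq_abs]
    calc |t| * ‖ζ‖ ≤ r * (1 / (4 * r)) := by gcongr
      _ = 1 / 4 := by field_simp
  have h2 := norm_sub_norm_le (1 : ℂ) ((t : ℂ) * ζ)
  rw [norm_one] at h2
  linarith

theorem one_sub_ne_zero {r t : ℝ} (hr : 0 < r) (ht : |t| ≤ r) {ζ : ℂ} (hζ : ‖ζ‖ < 1 / (4 * r)) :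
    1 - (t : ℂ) * ζ ≠ 0 := by
  intro h
  have := three_quarters_le hr ht hζ
  rw [h, norm_zero] at this
  linarith

theorem measurable_kernel (n : ℕ) (ζ : ℂ) :
    Measurable fun t : ℝ => (t : ℂ) ^ n / (1 - t * ζ) := by
  have : Measurable fun t : ℝ => (t : ℂ) := Complex.measurable_ofReal
  fun_prop

section
variable {μ : Measure ℝ} [IsProbabilityMeasure μ] {r : ℝ}

theorem integrable_kernel (hr : 0 < r) (hμ : μ (Set.Icc (-r) r) = 1) (n : ℕ) {ζ : ℂ}
    (hζ : ‖ζ‖ < 1 / (4 * r)) : Integrable (fun t : ℝ => (t : ℂ) ^ n / (1 - t * ζ)) μ := by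
  refine Integrable.of_bound (measurable_kernel n ζ).aestronglyMeasurable (r ^ n / (3 / 4)) ?_
  filter_upwards [ae_abs_le hμ] with t ht
  rw [norm_div, norm_pow, Complex.norm_real, Real.norm_eq_abs]
  have := three_quarters_le hr ht hζ
  gcongr

theorem integrable_pow (hr : 0 < r) (hμ : μ (Set.Icc (-r) r) = 1) (n : ℕ) :
    Integrable (fun t : ℝ => (t : ℂ) ^ n) μ := by
  have := integrable_kernel hr hμ n (ζ := 0) (by rw [norm_zero]; positivity)
  simpa using this

theorem moment_eq_integral (μ : Measure ℝ) (n : ℕ) : moment μ n = ∫ t : ℝ, (t : ℂ) ^ n ∂μ := by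
  rw [moment, ← integral_complex_ofReal]
  simp

theorem moment_zero (μ : Measure ℝ) [IsProbabilityMeasure μ] : moment μ 0 = 1 := by
  simp [moment]

theorem momentGen_eq (hr : 0 < r) (hμ : μ (Set.Icc (-r) r) = 1) (n : ℕ) {ζ : ℂ}
    (hζ : ‖ζ‖ < 1 / (4 * r)) : momentGen μ n ζ = moment μ n + ζ * momentGen μ (n + 1) ζ := by
  rw [moment_eq_integral, momentGen, momentGen, ← integral_const_mul,
    ← integral_add (integrable_pow hr hμ n) ((integrable_kernel hr hμ (n + 1) hζ).const_mul ζ)]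
  refine integral_congr_ae ?_
  filter_upwards [ae_abs_le hμ] with t ht
  have := one_sub_ne_zero hr ht hζ
  field_simp
  ring

theorem integrable_kernel_mul (hr : 0 < r) (hμ : μ (Set.Icc (-r) r) = 1) (n : ℕ) {ζ ξ : ℂ}
    (hζ : ‖ζ‖ < 1 / (4 * r)) (hξ : ‖ξ‖ < 1 / (4 * r)) :
    Integrable (fun t : ℝ => (t : ℂ) ^ n / ((1 - t * ζ) * (1 - t * ξ))) μ := by
  refine Integrable.of_bound ?_ (r ^ n / (3 / 4 * (3 / 4))) ?_
  · have : Measurable fun t : ℝ => (t : ℂ) := Complex.measurable_ofReal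
    exact Measurable.aestronglyMeasurable (by fun_prop)
  filter_upwards [ae_abs_le hμ] with t ht
  rw [norm_div, norm_pow, Complex.norm_real, Real.norm_eq_abs, norm_mul]
  have := three_quarters_le hr ht hζ
  have := three_quarters_le hr ht hξ
  gcongr

theorem momentGen_sub (hr : 0 < r) (hμ : μ (Set.Icc (-r) r) = 1) (n : ℕ) {ζ ξ : ℂ}
    (hζ : ‖ζ‖ < 1 / (4 * r)) (hξ : ‖ξ‖ < 1 / (4 * r)) :
    momentGen μ n ζ - momentGen μ n ξ
      = (ζ - ξ) * ∫ t : ℝ, (t : ℂ) ^ (n + 1) / ((1 - t * ζ) * (1 - t * ξ)) ∂μ := by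
  rw [momentGen, momentGen, ← integral_const_mul,
    ← integral_sub (integrable_kernel hr hμ n hζ) (integrable_kernel hr hμ n hξ)]
  refine integral_congr_ae ?_
  filter_upwards [ae_abs_le hμ] with t ht
  have := one_sub_ne_zero hr ht hζ
  have := one_sub_ne_zero hr ht hξ
  field_simp
  ring

theorem cauchyInv_sub (hr : 0 < r) (hμ : μ (Set.Icc (-r) r) = 1) {ζ ξ : ℂ}
    (hζ : ‖ζ‖ < 1 / (4 * r)) (hξ : ‖ξ‖ < 1 / (4 * r)) :
    cauchyInv μ ζ - cauchyInv μ ξ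
      = (ζ - ξ) * ∫ t : ℝ, (t : ℂ) ^ 0 / ((1 - t * ζ) * (1 - t * ξ)) ∂μ := by
  rw [cauchyInv, cauchyInv, momentGen, momentGen, ← integral_const_mul, ← integral_const_mul,
    ← integral_const_mul, ← integral_sub ((integrable_kernel hr hμ 0 hζ).const_mul _)
      ((integrable_kernel hr hμ 0 hξ).const_mul _)]
  refine integral_congr_ae ?_
  filter_upwards [ae_abs_le hμ] with t ht
  have h1 := one_sub_ne_zero hr ht hζ
  have h2 := one_sub_ne_zero hr ht hξ
  rw [pow_zero, mul_one_div, mul_one_div, mul_one_div, div_sub_div _ _ h1 h2]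
  ring

theorem norm_momentGen_sub_one_le (hr : 0 < r) (hμ : μ (Set.Icc (-r) r) = 1) {ζ : ℂ}
    (hζ : ‖ζ‖ < 1 / (4 * r)) : ‖momentGen μ 0 ζ - 1‖ ≤ 1 / 3 := by
  rw [momentGen_eq hr hμ 0 hζ, moment_zero, add_sub_cancel_left, momentGen, ← integral_const_mul]
  refine (norm_integral_le_of_norm_le_const (C := 1 / 3) ?_).trans (by simp)
  filter_upwards [ae_abs_le hμ] with t ht
  have h1 := three_quarters_le hr ht hζ
  rw [norm_mul, norm_div, norm_pow, Complex.norm_real, Real.norm_eq_abs, zero_add, pow_one]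
  calc ‖ζ‖ * (|t| / ‖1 - (t : ℂ) * ζ‖) ≤ 1 / (4 * r) * (r / (3 / 4)) := by gcongr
    _ = 1 / 3 := by field_simp

theorem two_thirds_le_norm_momentGen (hr : 0 < r) (hμ : μ (Set.Icc (-r) r) = 1) {ζ : ℂ}
    (hζ : ‖ζ‖ < 1 / (4 * r)) : 2 / 3 ≤ ‖momentGen μ 0 ζ‖ := by
  have h1 := norm_momentGen_sub_one_le hr hμ hζ
  have h2 := norm_sub_norm_le (1 : ℂ) (momentGen μ 0 ζ)
  rw [norm_one, norm_sub_rev] at h2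
  linarith

theorem momentGen_zero_ne_zero (hr : 0 < r) (hμ : μ (Set.Icc (-r) r) = 1) {ζ : ℂ}
    (hζ : ‖ζ‖ < 1 / (4 * r)) : momentGen μ 0 ζ ≠ 0 := by
  intro h
  have := two_thirds_le_norm_momentGen hr hμ hζ
  rw [h, norm_zero] at this
  linarith

/-- `ζ ↦ G(1 / ζ)` stretches distances by at least `2/9`, because the integrand of its difference
quotient is at distance at most `(4/3)² - 1 = 7/9` from `1`. -/
theorem le_norm_cauchyInv_sub (hr : 0 < r) (hμ : μ (Set.Icc (-r) r) = 1) {ζ ξ : ℂ}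
    (hζ : ‖ζ‖ < 1 / (4 * r)) (hξ : ‖ξ‖ < 1 / (4 * r)) :
    2 / 9 * ‖ζ - ξ‖ ≤ ‖cauchyInv μ ζ - cauchyInv μ ξ‖ := by
  have hI : ‖(∫ t : ℝ, (t : ℂ) ^ 0 / ((1 - t * ζ) * (1 - t * ξ)) ∂μ) - 1‖ ≤ 7 / 9 := by
    have h1 : (1 : ℂ) = ∫ _t : ℝ, (1 : ℂ) ∂μ := by simp
    nth_rewrite 3 [h1]
    rw [← integral_sub (integrable_kernel_mul hr hμ 0 hζ hξ) (integrable_const _)]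
    refine (norm_integral_le_of_norm_le_const (C := 7 / 9) ?_).trans (by simp)
    filter_upwards [ae_abs_le hμ] with t ht
    have ha : ∀ {η : ℂ}, ‖η‖ < 1 / (4 * r) → ‖(1 - (t : ℂ) * η)⁻¹ - 1‖ ≤ 1 / 3 := by
      intro η hη
      have h2 := one_sub_ne_zero hr ht hη
      have h3 := three_quarters_le hr ht hη
      have h4 : (1 - (t : ℂ) * η)⁻¹ - 1 = t * η / (1 - t * η) := by field_simp; ring
      rw [h4, norm_div, norm_mul, Complex.norm_real, Real.norm_eq_abs]
      calc |t| * ‖η‖ / ‖1 - (t : ℂ) * η‖ ≤ r * (1 / (4 * r)) / (3 / 4) := by gcongr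
        _ = 1 / 3 := by field_simp
    have h5 : (t : ℂ) ^ 0 / ((1 - t * ζ) * (1 - t * ξ)) - 1
        = ((1 - (t : ℂ) * ζ)⁻¹ - 1) * ((1 - (t : ℂ) * ξ)⁻¹ - 1) + ((1 - (t : ℂ) * ζ)⁻¹ - 1)
          + ((1 - (t : ℂ) * ξ)⁻¹ - 1) := by
      rw [pow_zero, one_div, mul_inv]; ring
    rw [h5]
    refine (norm_add₃_le).trans ?_
    rw [norm_mul]
    have h6 := ha hζ
    have h7 := ha hξ
    have h8 : ‖(1 - (t : ℂ) * ζ)⁻¹ - 1‖ * ‖(1 - (t : ℂ) * ξ)⁻¹ - 1‖ ≤ 1 / 3 * (1 / 3) := by gcongr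
    linarith
  rw [cauchyInv_sub hr hμ hζ hξ, norm_mul, mul_comm]
  set I := ∫ t : ℝ, (t : ℂ) ^ 0 / ((1 - t * ζ) * (1 - t * ξ)) ∂μ
  have h2 := norm_sub_norm_le (1 : ℂ) I
  rw [norm_one, norm_sub_rev] at h2
  gcongr
  linarith

theorem norm_momentGen_sub_le (hr : 0 < r) (hμ : μ (Set.Icc (-r) r) = 1) {ζ ξ : ℂ}
    (hζ : ‖ζ‖ < 1 / (4 * r)) (hξ : ‖ξ‖ < 1 / (4 * r)) :
    ‖momentGen μ 0 ζ - momentGen μ 0 ξ‖ ≤ 16 * r / 9 * ‖ζ - ξ‖ := by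
  rw [momentGen_sub hr hμ 0 hζ hξ, norm_mul, mul_comm]
  gcongr
  refine (norm_integral_le_of_norm_le_const (C := 16 * r / 9) ?_).trans (by simp)
  filter_upwards [ae_abs_le hμ] with t ht
  rw [norm_div, norm_pow, Complex.norm_real, Real.norm_eq_abs, norm_mul, zero_add, pow_one]
  have := three_quarters_le hr ht hζ
  have := three_quarters_le hr ht hξ
  calc |t| / (‖1 - (t : ℂ) * ζ‖ * ‖1 - (t : ℂ) * ξ‖) ≤ r / (3 / 4 * (3 / 4)) := by gcongr
    _ = 16 * r / 9 := by ring

theorem injOn_cauchyInv (hr : 0 < r) (hμ : μ (Set.Icc (-r) r) = 1) :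
    Set.InjOn (cauchyInv μ) (Metric.ball 0 (1 / (4 * r))) := by
  intro ζ hζ ξ hξ h
  have := le_norm_cauchyInv_sub hr hμ (mem_ball_zero_iff.1 hζ) (mem_ball_zero_iff.1 hξ)
  rw [h, sub_self, norm_zero] at this
  exact sub_eq_zero.1 (norm_le_zero_iff.1 (by linarith))

theorem differentiableOn_momentGen (hr : 0 < r) (hμ : μ (Set.Icc (-r) r) = 1) (n : ℕ) :
    DifferentiableOn ℂ (momentGen μ n) (Metric.ball 0 (1 / (4 * r))) := by
  intro ζ₀ hζ₀
  have hs : Metric.ball (0 : ℂ) (1 / (4 * r)) ∈ 𝓝 ζ₀ := Metric.isOpen_ball.mem_nhds hζ₀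
  refine (hasDerivAt_integral_of_dominated_loc_of_deriv_le (μ := μ)
    (F := fun ζ t => (t : ℂ) ^ n / (1 - t * ζ))
    (F' := fun ζ t => (t : ℂ) ^ (n + 1) / ((1 - t * ζ) * (1 - t * ζ)))
    (bound := fun _ => r ^ (n + 1) / (3 / 4 * (3 / 4))) hs
    (Eventually.of_forall fun ζ => (measurable_kernel n ζ).aestronglyMeasurable)
    (integrable_kernel hr hμ n (mem_ball_zero_iff.1 hζ₀))
    (integrable_kernel_mul hr hμ (n + 1) (mem_ball_zero_iff.1 hζ₀)
      (mem_ball_zero_iff.1 hζ₀)).aestronglyMeasurable ?_ (integrable_const _)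
    ?_).2.differentiableAt.differentiableWithinAt
  · filter_upwards [ae_abs_le hμ] with t ht ζ hζ
    rw [norm_div, norm_pow, Complex.norm_real, Real.norm_eq_abs, norm_mul]
    have := three_quarters_le hr ht (mem_ball_zero_iff.1 hζ)
    gcongr
  · filter_upwards [ae_abs_le hμ] with t ht ζ hζ
    have hne := one_sub_ne_zero hr ht (mem_ball_zero_iff.1 hζ)
    have h1 : HasDerivAt (fun ζ : ℂ => 1 - (t : ℂ) * ζ) (-(t : ℂ)) ζ := by
      simpa using ((hasDerivAt_id ζ).const_mul (t : ℂ)).const_sub 1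
    have h2 := (h1.inv hne).const_mul ((t : ℂ) ^ n)
    refine (h2.congr_deriv ?_)
    field_simp
    ring

/-- The disc `|w| < 1 / (6 r)` is in the range of `ζ ↦ ζ M(ζ)`, by the contraction principle. -/
theorem exists_cauchyInv_eq (hr : 0 < r) (hμ : μ (Set.Icc (-r) r) = 1) {w : ℂ}
    (hw : ‖w‖ < 1 / (6 * r)) : ∃ ζ ∈ Metric.ball (0 : ℂ) (1 / (4 * r)), cauchyInv μ ζ = w := by
  have hρ : 3 / 2 * ‖w‖ < 1 / (4 * r) := by
    calc 3 / 2 * ‖w‖ < 3 / 2 * (1 / (6 * r)) := by gcongr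
      _ = 1 / (4 * r) := by field_simp; norm_num
  set s := Metric.closedBall (0 : ℂ) (3 / 2 * ‖w‖) with hs
  have hsB : ∀ ζ ∈ s, ‖ζ‖ < 1 / (4 * r) := fun ζ hζ => (mem_closedBall_zero_iff.1 hζ).trans_lt hρ
  -- the equation says that `ζ` is a fixed point of `ζ ↦ w / M(ζ)`, which is a contraction
  let T : ℂ → ℂ := fun ζ => w / momentGen μ 0 ζ
  have hmaps : Set.MapsTo T s s := by
    intro ζ hζ
    rw [hs, mem_closedBall_zero_iff, norm_div]
    have := two_thirds_le_norm_momentGen hr hμ (hsB ζ hζ)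
    calc ‖w‖ / ‖momentGen μ 0 ζ‖ ≤ ‖w‖ / (2 / 3) := by gcongr
      _ = 3 / 2 * ‖w‖ := by ring
  have hcontr : ContractingWith (2 / 3) (hmaps.restrict T s s) := by
    refine ⟨by rw [div_lt_one (by norm_num)]; norm_num, LipschitzWith.of_dist_le_mul ?_⟩
    rintro ⟨ζ, hζ⟩ ⟨ξ, hξ⟩
    have h1 := two_thirds_le_norm_momentGen hr hμ (hsB ζ hζ)
    have h2 := two_thirds_le_norm_momentGen hr hμ (hsB ξ hξ)
    have h3 := norm_momentGen_sub_le hr hμ (hsB ξ hξ) (hsB ζ hζ)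
    have h1' := momentGen_zero_ne_zero hr hμ (hsB ζ hζ)
    have h2' := momentGen_zero_ne_zero hr hμ (hsB ξ hξ)
    change dist (T ζ) (T ξ) ≤ (2 / 3 : ℝ) * dist ζ ξ
    rw [dist_eq_norm, dist_eq_norm]
    have h4 : T ζ - T ξ = w * (momentGen μ 0 ξ - momentGen μ 0 ζ)
        / (momentGen μ 0 ζ * momentGen μ 0 ξ) := by
      simp only [T]
      field_simp
    rw [h4, norm_div, norm_mul, norm_mul]
    calc ‖w‖ * ‖momentGen μ 0 ξ - momentGen μ 0 ζ‖ / (‖momentGen μ 0 ζ‖ * ‖momentGen μ 0 ξ‖)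
        ≤ 1 / (6 * r) * (16 * r / 9 * ‖ξ - ζ‖) / (2 / 3 * (2 / 3)) := by gcongr
      _ = 2 / 3 * ‖ζ - ξ‖ := by rw [norm_sub_rev ξ ζ]; field_simp; ring
  obtain ⟨ζ, hζ, hfix, -⟩ := hcontr.exists_fixedPoint' Metric.isClosed_closedBall.isComplete hmaps
    (Metric.mem_closedBall_self (by positivity)) (edist_ne_top _ _)
  refine ⟨ζ, mem_ball_zero_iff.2 (hsB ζ hζ), ?_⟩
  have h1 : w / momentGen μ 0 ζ = ζ := hfix
  rw [cauchyInv]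
  nth_rewrite 1 [← h1]
  exact div_mul_cancel₀ _ (momentGen_zero_ne_zero hr hμ (hsB ζ hζ))

end

theorem cauchyTransform_eq (μ : Measure ℝ) {z : ℂ} (hz : z ≠ 0) :
    cauchyTransform μ z = cauchyInv μ z⁻¹ := by
  rw [cauchyTransform, cauchyInv, momentGen, ← integral_const_mul]
  congr 1
  funext t
  rw [pow_zero, mul_one_div, ← div_eq_mul_inv, one_sub_div hz, inv_eq_one_div,
    div_div_div_cancel_right₀ hz]

theorem kTransform_eq_add (μ : Measure ℝ) (r : ℝ) {w : ℂ} (hw : w ≠ 0) :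
    kTransform μ r w = 1 / w + rTransform μ r w := by
  rw [rTransform, Function.update_of_ne hw]; ring

/-! ### The inverse of the Cauchy transform -/

/-- The inverse of `ζ ↦ ζ M(ζ)` on the disc `|ζ| < 1 / (4 r)`. -/
def gInv (μ : Measure ℝ) (r : ℝ) : ℂ → ℂ :=
  Function.invFunOn (cauchyInv μ) (Metric.ball 0 (1 / (4 * r)))

section
variable {μ : Measure ℝ} [IsProbabilityMeasure μ] {r : ℝ}

theorem gInv_mem (hr : 0 < r) (hμ : μ (Set.Icc (-r) r) = 1) {w : ℂ} (hw : w ∈ domV r) :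
    ‖gInv μ r w‖ < 1 / (4 * r) :=
  mem_ball_zero_iff.1 (Function.invFunOn_mem (exists_cauchyInv_eq hr hμ hw))

theorem cauchyInv_gInv (hr : 0 < r) (hμ : μ (Set.Icc (-r) r) = 1) {w : ℂ} (hw : w ∈ domV r) :
    cauchyInv μ (gInv μ r w) = w :=
  Function.invFunOn_eq (exists_cauchyInv_eq hr hμ hw)

theorem gInv_cauchyInv (hr : 0 < r) (hμ : μ (Set.Icc (-r) r) = 1) {ζ : ℂ}
    (hζ : ‖ζ‖ < 1 / (4 * r)) (hV : cauchyInv μ ζ ∈ domV r) : gInv μ r (cauchyInv μ ζ) = ζ :=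
  injOn_cauchyInv hr hμ (mem_ball_zero_iff.2 (gInv_mem hr hμ hV)) (mem_ball_zero_iff.2 hζ)
    (cauchyInv_gInv hr hμ hV)

theorem isOpen_domV (r : ℝ) : IsOpen (domV r) := isOpen_lt continuous_norm continuous_const

theorem zero_mem_domV (hr : 0 < r) : (0 : ℂ) ∈ domV r := by
  change ‖(0 : ℂ)‖ < _
  rw [norm_zero]; positivity

theorem differentiableOn_cauchyInv (hr : 0 < r) (hμ : μ (Set.Icc (-r) r) = 1) :
    DifferentiableOn ℂ (cauchyInv μ) (Metric.ball 0 (1 / (4 * r))) :=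
  differentiableOn_id.mul (differentiableOn_momentGen hr hμ 0)

theorem differentiableOn_gInv (hr : 0 < r) (hμ : μ (Set.Icc (-r) r) = 1) :
    DifferentiableOn ℂ (gInv μ r) (domV r) := by
  intro w hw
  have hV := (isOpen_domV r).mem_nhds hw
  have hg := gInv_mem hr hμ hw
  have hlip : ∀ v ∈ domV r, ‖gInv μ r v - gInv μ r w‖ ≤ 9 / 2 * ‖v - w‖ := by
    intro v hv
    have := le_norm_cauchyInv_sub hr hμ (gInv_mem hr hμ hv) hg
    rw [cauchyInv_gInv hr hμ hv, cauchyInv_gInv hr hμ hw] at this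
    linarith
  have hcont : ContinuousAt (gInv μ r) w := by
    rw [ContinuousAt, tendsto_iff_norm_sub_tendsto_zero]
    have h0 : Tendsto (fun v => 9 / 2 * ‖v - w‖) (𝓝 w) (𝓝 0) := by
      have : Continuous fun v : ℂ => 9 / 2 * ‖v - w‖ := by fun_prop
      simpa using this.tendsto w
    exact squeeze_zero' (Eventually.of_forall fun _ => norm_nonneg _)
      (eventually_of_mem hV hlip) h0
  have hB : Metric.ball (0 : ℂ) (1 / (4 * r)) ∈ 𝓝 (gInv μ r w) :=
    Metric.isOpen_ball.mem_nhds (mem_ball_zero_iff.2 hg)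
  have hd := ((differentiableOn_cauchyInv hr hμ).differentiableAt hB).hasDerivAt
  refine (HasDerivAt.of_local_left_inverse hcont hd ?_
    (eventually_of_mem hV fun v hv => cauchyInv_gInv hr hμ hv)).differentiableAt.differentiableWithinAt
  have hle : 2 / 9 ≤ ‖deriv (cauchyInv μ) (gInv μ r w)‖ := by
    refine ge_of_tendsto hd.tendsto_slope.norm ?_
    filter_upwards [nhdsWithin_le_nhds hB, self_mem_nhdsWithin] with ζ hζ hne
    rw [slope_def_field, norm_div, le_div_iff₀ (norm_pos_iff.2 (sub_ne_zero.2 hne))]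
    exact le_norm_cauchyInv_sub hr hμ (mem_ball_zero_iff.1 hζ) hg
  intro h
  rw [h, norm_zero] at hle
  linarith

/-- With `g` the inverse of `ζ ↦ ζ h₀(ζ)`, the difference `1 / g(w) - 1 / w` is
`h₁(g(w)) / h₀(g(w))`, an expression that makes sense at `w = 0` too. -/
theorem inv_gInv_eq (hr : 0 < r) (hμ : μ (Set.Icc (-r) r) = 1) {w : ℂ} (hw : w ∈ domV r)
    (hw0 : w ≠ 0) :
    (gInv μ r w)⁻¹ = 1 / w + momentGen μ 1 (gInv μ r w) / momentGen μ 0 (gInv μ r w) := by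
  have hg := gInv_mem hr hμ hw
  have h0 := momentGen_zero_ne_zero hr hμ hg
  have h1 : gInv μ r w * momentGen μ 0 (gInv μ r w) = w := cauchyInv_gInv hr hμ hw
  have h2 := momentGen_eq hr hμ 0 hg
  rw [moment_zero, zero_add] at h2
  have hg0 : gInv μ r w ≠ 0 := fun h => hw0 (by rw [← h1, h, zero_mul])
  have h3 : 1 / w = 1 / (gInv μ r w * momentGen μ 0 (gInv μ r w)) := by rw [h1]
  rw [h3]
  field_simp
  linear_combination h2

theorem norm_inv_lt_iff_mem_domU (hr : 0 < r) {z : ℂ} (hz : z ≠ 0) :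
    ‖z⁻¹‖ < 1 / (4 * r) ↔ z ∈ domU r := by
  change _ ↔ 4 * r < ‖z‖
  rw [norm_inv, ← one_div, one_div_lt_one_div (norm_pos_iff.2 hz) (by positivity)]

theorem ne_zero_of_mem_domU (hr : 0 < r) {z : ℂ} (hz : z ∈ domU r) : z ≠ 0 := by
  rintro rfl
  change 4 * r < ‖(0 : ℂ)‖ at hz
  rw [norm_zero] at hz
  linarith

theorem kTransform_eq (hr : 0 < r) (hμ : μ (Set.Icc (-r) r) = 1) {w : ℂ} (hw : w ∈ domV r)
    (hw0 : w ≠ 0) : kTransform μ r w ∈ domU r ∧ cauchyTransform μ (kTransform μ r w) = w ∧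
      kTransform μ r w = (gInv μ r w)⁻¹ := by
  have hg0 : gInv μ r w ≠ 0 := fun h => hw0 (by
    rw [← cauchyInv_gInv hr hμ hw, h, cauchyInv, zero_mul])
  have hU : (gInv μ r w)⁻¹ ∈ domU r := by
    rw [← norm_inv_lt_iff_mem_domU hr (inv_ne_zero hg0), inv_inv]
    exact gInv_mem hr hμ hw
  have hex : ∃ z ∈ domU r, cauchyTransform μ z = w :=
    ⟨_, hU, by rw [cauchyTransform_eq μ (inv_ne_zero hg0), inv_inv, cauchyInv_gInv hr hμ hw]⟩
  have h1 : kTransform μ r w ∈ domU r := Function.invFunOn_mem hex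
  have h2 : cauchyTransform μ (kTransform μ r w) = w := Function.invFunOn_eq hex
  refine ⟨h1, h2, ?_⟩
  have hne := ne_zero_of_mem_domU hr h1
  have h3 := (norm_inv_lt_iff_mem_domU hr hne).2 h1
  rw [cauchyTransform_eq μ hne] at h2
  rw [← inv_inv (kTransform μ r w)]
  congr 1
  have h4 := gInv_cauchyInv hr hμ h3 (h2.symm ▸ hw)
  rw [← h4, h2]

theorem analyticOnNhd_momentGen_gInv (hr : 0 < r) (hμ : μ (Set.Icc (-r) r) = 1) (n : ℕ) :
    AnalyticOnNhd ℂ (fun w => momentGen μ n (gInv μ r w)) (domV r) :=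
  ((differentiableOn_momentGen hr hμ n).comp (differentiableOn_gInv hr hμ)
    fun _ hw => mem_ball_zero_iff.2 (gInv_mem hr hμ hw)).analyticOnNhd (isOpen_domV r)

theorem rTransform_eq (hr : 0 < r) (hμ : μ (Set.Icc (-r) r) = 1) {w : ℂ} (hw : w ∈ domV r) :
    rTransform μ r w = momentGen μ 1 (gInv μ r w) / momentGen μ 0 (gInv μ r w) := by
  have key : ∀ w ∈ domV r, w ≠ 0 → kTransform μ r w - 1 / w
      = momentGen μ 1 (gInv μ r w) / momentGen μ 0 (gInv μ r w) := fun w hw hw0 => by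
    rw [(kTransform_eq hr hμ hw hw0).2.2, inv_gInv_eq hr hμ hw hw0, add_sub_cancel_left]
  by_cases hw0 : w = 0
  · subst hw0
    rw [rTransform, Function.update_self]
    refine Tendsto.limUnder_eq ?_
    have hc : ContinuousAt (fun w => momentGen μ 1 (gInv μ r w) / momentGen μ 0 (gInv μ r w)) 0 :=
      ((analyticOnNhd_momentGen_gInv hr hμ 1 0 hw).div (analyticOnNhd_momentGen_gInv hr hμ 0 0 hw)
        (momentGen_zero_ne_zero hr hμ (gInv_mem hr hμ hw))).continuousAt
    refine (hc.tendsto.mono_left nhdsWithin_le_nhds).congr' ?_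
    filter_upwards [nhdsWithin_le_nhds ((isOpen_domV r).mem_nhds hw), self_mem_nhdsWithin]
      with v hv hv0
    exact (key v hv hv0).symm
  · rw [rTransform, Function.update_of_ne hw0, key w hw hw0]

theorem analyticOnNhd_rTransform (hr : 0 < r) (hμ : μ (Set.Icc (-r) r) = 1) :
    AnalyticOnNhd ℂ (rTransform μ r) (domV r) := by
  have h : AnalyticOnNhd ℂ
      (fun w => momentGen μ 1 (gInv μ r w) / momentGen μ 0 (gInv μ r w)) (domV r) :=
    (analyticOnNhd_momentGen_gInv hr hμ 1).div (analyticOnNhd_momentGen_gInv hr hμ 0)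
      fun w hw => momentGen_zero_ne_zero hr hμ (gInv_mem hr hμ hw)
  exact h.congr (isOpen_domV r) fun w hw => (rTransform_eq hr hμ hw).symm

theorem meromorphicOrderAt_kTransform (hr : 0 < r) (hμ : μ (Set.Icc (-r) r) = 1) :
    meromorphicOrderAt (kTransform μ r) 0 = -1 := by
  have h0 := zero_mem_domV hr
  have han := analyticOnNhd_rTransform hr hμ 0 h0
  have hg : AnalyticAt ℂ (fun w => 1 + w * rTransform μ r w) 0 :=
    analyticAt_const.add (analyticAt_id.mul han)
  have heq : ∀ᶠ w in 𝓝[≠] (0 : ℂ),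
      kTransform μ r w = (w - 0) ^ (-1 : ℤ) • (1 + w * rTransform μ r w) := by
    filter_upwards [nhdsWithin_le_nhds ((isOpen_domV r).mem_nhds h0), self_mem_nhdsWithin]
      with w hw hw0
    have hw0' : w ≠ 0 := hw0
    rw [kTransform_eq_add _ _ hw0, sub_zero, zpow_neg_one, smul_eq_mul]
    field_simp
  have hmer : MeromorphicAt (kTransform μ r) 0 := by
    have : MeromorphicAt (fun w : ℂ => (w - 0) ^ (-1 : ℤ) • (1 + w * rTransform μ r w)) 0 := by
      have h1 : MeromorphicAt (fun w : ℂ => w - 0) 0 := by fun_prop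
      exact (h1.zpow _).smul hg.meromorphicAt
    exact this.congr (heq.mono fun _ h => h.symm)
  have := (meromorphicOrderAt_eq_int_iff (n := -1) hmer).2 ⟨_, hg, by simp, heq⟩
  simpa using this

theorem norm_cauchyTransform_lt (hμ : μ (Set.Icc (-r) r) = 1) {z : ℂ} {s : ℝ}
    (hs : r < s) (hz : s < ‖z‖) : ‖cauchyTransform μ z‖ < 1 / (s - r) := by
  have hlt : 1 / (‖z‖ - r) < 1 / (s - r) := by
    apply one_div_lt_one_div_of_lt <;> linarith
  refine lt_of_le_of_lt ?_ hlt
  rw [cauchyTransform]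
  refine (norm_integral_le_of_norm_le_const (C := 1 / (‖z‖ - r)) ?_).trans (by simp)
  filter_upwards [ae_abs_le hμ] with t ht
  have h1 := norm_sub_norm_le z (t : ℂ)
  rw [Complex.norm_real, Real.norm_eq_abs] at h1
  rw [norm_div, norm_one]
  apply one_div_le_one_div_of_le <;> linarith

theorem cauchyTransform_ne_zero (hr : 0 < r) (hμ : μ (Set.Icc (-r) r) = 1) {z : ℂ}
    (hz : z ∈ domU r) : cauchyTransform μ z ≠ 0 := by
  have hne := ne_zero_of_mem_domU hr hz
  rw [cauchyTransform_eq μ hne, cauchyInv]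
  exact mul_ne_zero (inv_ne_zero hne)
    (momentGen_zero_ne_zero hr hμ ((norm_inv_lt_iff_mem_domU hr hne).2 hz))

theorem analyticOnNhd_cauchyTransform (hr : 0 < r) (hμ : μ (Set.Icc (-r) r) = 1) :
    AnalyticOnNhd ℂ (cauchyTransform μ) (domU r) := by
  have ho : IsOpen (domU r) := isOpen_lt continuous_const continuous_norm
  have hd : DifferentiableOn ℂ (fun z => cauchyInv μ z⁻¹) (domU r) :=
    (differentiableOn_cauchyInv hr hμ).comp
      (differentiableOn_id.inv fun z hz => ne_zero_of_mem_domU hr hz)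
      fun z hz => mem_ball_zero_iff.2 ((norm_inv_lt_iff_mem_domU hr (ne_zero_of_mem_domU hr hz)).2 hz)
  exact (hd.analyticOnNhd ho).congr ho fun z hz =>
    (cauchyTransform_eq μ (ne_zero_of_mem_domU hr hz)).symm

theorem injOn_cauchyTransform (hr : 0 < r) (hμ : μ (Set.Icc (-r) r) = 1) :
    Set.InjOn (cauchyTransform μ) (domU r) := by
  intro z hz w hw h
  have hz0 := ne_zero_of_mem_domU hr hz
  have hw0 := ne_zero_of_mem_domU hr hw
  rw [cauchyTransform_eq μ hz0, cauchyTransform_eq μ hw0] at h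
  exact inv_injective (injOn_cauchyInv hr hμ
    (mem_ball_zero_iff.2 ((norm_inv_lt_iff_mem_domU hr hz0).2 hz))
    (mem_ball_zero_iff.2 ((norm_inv_lt_iff_mem_domU hr hw0).2 hw)) h)

theorem tendsto_cauchyTransform (hμ : μ (Set.Icc (-r) r) = 1) :
    Tendsto (cauchyTransform μ) (Bornology.cobounded ℂ) (𝓝 0) := by
  rw [NormedAddGroup.tendsto_nhds_zero]
  intro ε hε
  filter_upwards [eventually_cobounded_le_norm (1 / ε + r + 1)] with z hz
  refine (norm_cauchyTransform_lt hμ (s := 1 / ε + r) ?_ (by linarith)).trans_eq ?_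
  · have : 0 < 1 / ε := by positivity
    linarith
  · rw [add_sub_cancel_right, one_div_one_div]

end

/-! ### Power series expansions at the origin -/

/-- `f` is the sum of the power series `p` in a neighbourhood of `0`. -/
def HasExpansion (f : ℂ → ℂ) (p : PowerSeries ℂ) : Prop :=
  ∀ᶠ z in 𝓝 (0 : ℂ), HasSum (fun n => PowerSeries.coeff n p * z ^ n) (f z)

theorem HasExpansion.hasFPowerSeriesAt {f : ℂ → ℂ} {p : PowerSeries ℂ} (h : HasExpansion f p) :
    HasFPowerSeriesAt f
      (FormalMultilinearSeries.ofScalars ℂ fun n => PowerSeries.coeff n p) 0 := by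
  rw [hasFPowerSeriesAt_iff]
  refine h.mono fun z hz => ?_
  simpa [mul_comm, FormalMultilinearSeries.coeff_ofScalars] using hz

theorem HasExpansion.unique {f g : ℂ → ℂ} {p q : PowerSeries ℂ} (hf : HasExpansion f p)
    (hg : HasExpansion g q) (h : ∀ᶠ z in 𝓝 0, f z = g z) : p = q := by
  have h1 := (hf.hasFPowerSeriesAt.congr h).eq_formalMultilinearSeries hg.hasFPowerSeriesAt
  ext n
  have h2 := congrArg (fun s => FormalMultilinearSeries.coeff s n) h1
  simpa [FormalMultilinearSeries.coeff_ofScalars] using h2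

theorem exists_hasExpansion {f : ℂ → ℂ} (hf : AnalyticAt ℂ f 0) : ∃ p, HasExpansion f p := by
  obtain ⟨s, hs⟩ := hf
  refine ⟨PowerSeries.mk s.coeff, (hasFPowerSeriesAt_iff.1 hs).mono fun z hz => ?_⟩
  simpa [mul_comm] using hz

theorem HasExpansion.add {f g : ℂ → ℂ} {p q : PowerSeries ℂ} (hf : HasExpansion f p)
    (hg : HasExpansion g q) : HasExpansion (fun z => f z + g z) (p + q) := by
  filter_upwards [hf, hg] with z h1 h2
  simpa [add_mul] using h1.add h2

theorem HasExpansion.mul {f g : ℂ → ℂ} {p q : PowerSeries ℂ} (hf : HasExpansion f p)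
    (hg : HasExpansion g q) : HasExpansion (fun z => f z * g z) (p * q) := by
  filter_upwards [hf, hg] with z h1 h2
  have n1 := h1.summable.norm
  have n2 := h2.summable.norm
  have h := (summable_norm_sum_mul_antidiagonal_of_summable_norm n1 n2).of_norm.hasSum
  rw [← tsum_mul_tsum_eq_tsum_sum_antidiagonal_of_summable_norm n1 n2, h1.tsum_eq, h2.tsum_eq] at h
  convert! h using 2 with n
  rw [PowerSeries.coeff_mul, Finset.sum_mul]
  refine Finset.sum_congr rfl fun k hk => ?_
  rw [← Finset.HasAntidiagonal.mem_antidiagonal.1 hk, pow_add]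
  ring

theorem hasExpansion_const (c : ℂ) : HasExpansion (fun _ => c) (PowerSeries.C c) := by
  refine Eventually.of_forall fun z => ?_
  convert! hasSum_ite_eq 0 c using 2 with n
  rw [PowerSeries.coeff_C]
  split_ifs with h <;> simp [h]

theorem hasExpansion_id : HasExpansion (fun z => z) PowerSeries.X := by
  refine Eventually.of_forall fun z => ?_
  convert! hasSum_ite_eq 1 z using 2 with n
  rw [PowerSeries.coeff_X]
  split_ifs with h <;> simp [h]

/-! ### The power series of the `R`-transform -/

section
variable {μ : Measure ℝ} [IsProbabilityMeasure μ] {r : ℝ}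

theorem analyticAt_momentGen (hr : 0 < r) (hμ : μ (Set.Icc (-r) r) = 1) (n : ℕ) :
    AnalyticAt ℂ (momentGen μ n) 0 :=
  (differentiableOn_momentGen hr hμ n).analyticOnNhd Metric.isOpen_ball 0
    (Metric.mem_ball_self (by positivity))

theorem eventually_norm_lt (hr : 0 < r) : ∀ᶠ ζ in 𝓝 (0 : ℂ), ‖ζ‖ < 1 / (4 * r) :=
  eventually_of_mem (Metric.ball_mem_nhds 0 (by positivity)) fun _ hζ => mem_ball_zero_iff.1 hζ

theorem hasExpansion_momentGen (hr : 0 < r) (hμ : μ (Set.Icc (-r) r) = 1) :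
    HasExpansion (momentGen μ 0) (PowerSeries.mk (moment μ)) := by
  choose s hs using fun n => exists_hasExpansion (analyticAt_momentGen hr hμ n)
  have h1 : ∀ n, s n = PowerSeries.C (moment μ n) + PowerSeries.X * s (n + 1) := fun n =>
    (hs n).unique ((hasExpansion_const _).add (hasExpansion_id.mul (hs (n + 1))))
      ((eventually_norm_lt hr).mono fun ζ hζ => momentGen_eq hr hμ n hζ)
  have h2 : ∀ k n, PowerSeries.coeff k (s n) = moment μ (n + k) := by
    intro k
    induction k with
    | zero => intro n; rw [h1]; simp
    | succ k ih =>
      intro n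
      rw [h1, map_add, PowerSeries.coeff_succ_X_mul, ih, PowerSeries.coeff_C,
        if_neg k.succ_ne_zero, zero_add]
      congr 1
      omega
  have h3 : s 0 = PowerSeries.mk (moment μ) := by
    ext k
    rw [h2, PowerSeries.coeff_mk, zero_add]
  rw [← h3]
  exact hs 0

/-- The functional equation `h₀(ζ) R(ζ h₀(ζ)) = h₁(ζ)`. -/
theorem eventually_rTransform_cauchyInv (hr : 0 < r) (hμ : μ (Set.Icc (-r) r) = 1) :
    ∀ᶠ ζ in 𝓝 (0 : ℂ),
      momentGen μ 0 ζ * rTransform μ r (cauchyInv μ ζ) = momentGen μ 1 ζ := by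
  have hc : ContinuousAt (cauchyInv μ) 0 :=
    (analyticAt_id.mul (analyticAt_momentGen hr hμ 0)).continuousAt
  have hV : domV r ∈ 𝓝 (cauchyInv μ 0) := by
    have : cauchyInv μ 0 = 0 := by simp [cauchyInv]
    rw [this]
    exact (isOpen_domV r).mem_nhds (zero_mem_domV hr)
  filter_upwards [eventually_norm_lt hr, hc hV] with ζ hζ hζV
  have hζV' : cauchyInv μ ζ ∈ domV r := hζV
  rw [rTransform_eq hr hμ hζV', gInv_cauchyInv hr hμ hζ hζV']
  exact mul_div_cancel₀ _ (momentGen_zero_ne_zero hr hμ hζ)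

/-- The Taylor coefficients of the `R`-transform are the free cumulants. With `R_k` the `k`-fold
difference quotient of `R` at `0`, the series `P_k` of `M(ζ) R_k(ζ M(ζ))` satisfy the recursion of
the generating functions of non-crossing partitions. -/
theorem hasSum_rTransform (hr : 0 < r) (hμ : μ (Set.Icc (-r) r) = 1) {z : ℂ} (hz : z ∈ domV r) :
    HasSum (fun n : ℕ => freeCumulant (moment μ) (n + 1) * z ^ n) (rTransform μ r z) := by
  have hpos : 0 < 1 / (6 * r) := by positivity
  have hball : domV r = Metric.ball 0 (1 / (6 * r)) := by
    ext w; rw [mem_ball_zero_iff]; rfl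
  have han := analyticOnNhd_rTransform hr hμ
  -- the Cauchy power series does not depend on the radius of the circle
  obtain ⟨p, hp⟩ : ∃ p : FormalMultilinearSeries ℂ ℂ ℂ,
      ∀ s : ℝ, 0 < s → s < 1 / (6 * r) →
        HasFPowerSeriesOnBall (rTransform μ r) p 0 (ENNReal.ofReal s) := by
    refine ⟨cauchyPowerSeries (rTransform μ r) 0 (1 / (12 * r)), fun s hs hs' => ?_⟩
    have hd : ∀ t : ℝ, 0 < t → t < 1 / (6 * r) → HasFPowerSeriesOnBall (rTransform μ r)
        (cauchyPowerSeries (rTransform μ r) 0 t) 0 (ENNReal.ofReal t) := by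
      intro t ht ht'
      have h1 : DifferentiableOn ℂ (rTransform μ r) (Metric.closedBall 0 t) := by
        refine han.differentiableOn.mono ?_
        rw [hball]
        exact Metric.closedBall_subset_ball ht'
      have := DifferentiableOn.hasFPowerSeriesOnBall (R := t.toNNReal) (c := (0 : ℂ))
        (by rwa [Real.coe_toNNReal _ ht.le]) (by simpa using ht)
      rwa [Real.coe_toNNReal _ ht.le] at this
    have h12 : 1 / (12 * r) < 1 / (6 * r) := by
      apply one_div_lt_one_div_of_lt <;> linarith
    rw [(hd _ (by positivity) h12).hasFPowerSeriesAt.eq_formalMultilinearSeries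
      (hd s hs hs').hasFPowerSeriesAt]
    exact hd s hs hs'
  have hp0 : HasFPowerSeriesAt (rTransform μ r) p 0 :=
    (hp (1 / (12 * r)) (by positivity)
      (by apply one_div_lt_one_div_of_lt <;> linarith)).hasFPowerSeriesAt
  -- the iterated difference quotients of `R` at `0`
  let Rk : ℕ → ℂ → ℂ := fun k => (Function.swap dslope 0)^[k] (rTransform μ r)
  have hRk : ∀ k, HasFPowerSeriesAt (Rk k) (FormalMultilinearSeries.fslope^[k] p) 0 := fun k =>
    hp0.has_fpower_series_iterate_dslope_fslope k
  have hRk0 : ∀ k, Rk k 0 = p.coeff k := by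
    intro k
    have h1 := (hRk k).coeff_zero 1
    have h2 : (FormalMultilinearSeries.fslope^[k] p).coeff 0 = p.coeff (0 + k) :=
      FormalMultilinearSeries.coeff_iterate_fslope k 0
    rw [zero_add] at h2
    rw [← h2, ← h1]
    rfl
  have hRstep : ∀ k w, Rk k w = p.coeff k + w * Rk (k + 1) w := by
    intro k w
    have h1 : Rk (k + 1) w = dslope (Rk k) 0 w := by
      simp only [Rk, Function.iterate_succ_apply']
    have h2 := sub_smul_dslope (Rk k) 0 w
    rw [sub_zero, smul_eq_mul, hRk0] at h2
    rw [h1, h2]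
    ring
  have hc0 : cauchyInv μ 0 = 0 := by simp [cauchyInv]
  have hcan : AnalyticAt ℂ (cauchyInv μ) 0 := analyticAt_id.mul (analyticAt_momentGen hr hμ 0)
  have hPan : ∀ k, AnalyticAt ℂ (fun ζ => momentGen μ 0 ζ * Rk k (cauchyInv μ ζ)) 0 := fun k =>
    (analyticAt_momentGen hr hμ 0).mul (((hRk k).analyticAt).comp_of_eq hcan hc0)
  choose P hP using fun k => exists_hasExpansion (hPan k)
  have hM := hasExpansion_momentGen hr hμ
  have hM1 : HasExpansion (fun _ => (1 : ℂ)) 1 := by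
    simpa using hasExpansion_const 1
  have key := freeCumulant_eq_of_powerSeries (m := moment μ) (c := p.coeff) (P := P)
    (hM.unique (hM1.add (hasExpansion_id.mul (hP 0))) (by
      filter_upwards [eventually_norm_lt hr, eventually_rTransform_cauchyInv hr hμ] with ζ hζ hR
      have h1 := momentGen_eq hr hμ 0 hζ
      rw [moment_zero, zero_add, ← hR] at h1
      exact h1))
    (fun k => (hP k).unique
      (((hasExpansion_const _).mul hM).add (hasExpansion_id.mul (hM.mul (hP (k + 1)))))
      (Eventually.of_forall fun ζ => by
        rw [hRstep k, cauchyInv]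
        ring))
  simp_rw [key]
  have hz' : ‖z‖ < 1 / (6 * r) := hz
  obtain ⟨s, hs1, hs2⟩ := exists_between hz'
  have h := (hp s ((norm_nonneg z).trans_lt hs1) hs2).hasSum (y := z) (by
    rw [Metric.eball_ofReal, mem_ball_zero_iff]
    exact hs1)
  rw [zero_add] at h
  convert! h using 2 with n
  rw [FormalMultilinearSeries.apply_eq_pow_smul_coeff, smul_eq_mul, mul_comm]

end

/-! ### The formal relation between moments and the inverse of the Cauchy transform -/

/-- The relation `G(K(w)) = w` in terms of the formal power series `κ = w K(w)`: there are power
series `a_n`, the expansions of `∫ t ^ n / (κ - t w) dμ(t)`, with `a_0 = 1`. -/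
def InvertsMoments (κ : PowerSeries ℂ) (m : ℕ → ℂ) : Prop :=
  ∃ a : ℕ → PowerSeries ℂ, a 0 = 1 ∧
    ∀ n, κ * a n = PowerSeries.C (m n) + PowerSeries.X * a (n + 1)

theorem InvertsMoments.coeff_zero {κ : PowerSeries ℂ} {m : ℕ → ℂ} (h : InvertsMoments κ m) :
    PowerSeries.coeff 0 κ = m 0 := by
  obtain ⟨a, h0, ha⟩ := h
  have := ha 0
  rw [h0, mul_one] at this
  rw [this]
  simp

theorem InvertsMoments.moments_unique {κ : PowerSeries ℂ} {m m' : ℕ → ℂ}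
    (h : InvertsMoments κ m) (h' : InvertsMoments κ m') : m = m' := by
  obtain ⟨a, h0, ha⟩ := h
  obtain ⟨a', h0', ha'⟩ := h'
  have hm : ∀ n, a n = a' n → m n = m' n := by
    intro n hn
    have := congrArg (PowerSeries.coeff 0) ((ha n).symm.trans (hn ▸ ha' n))
    simpa using this
  have hall : ∀ n, a n = a' n := by
    intro n
    induction n with
    | zero => rw [h0, h0']
    | succ n ih =>
      have := (ha n).symm.trans (ih ▸ ha' n)
      rw [hm n ih] at this
      exact mul_left_cancel₀ PowerSeries.X_ne_zero (add_left_cancel this)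
  exact funext fun n => hm n (hall n)

/-- In the recursion `κ a_n = m_n + X a_{n+1}`, the coefficients of `κ` of order less than `N`
determine those of all `a_n`. -/
theorem coeff_eq_of_recursion {κ κ' : PowerSeries ℂ} {m : ℕ → ℂ} {a a' : ℕ → PowerSeries ℂ}
    (hκ0 : PowerSeries.coeff 0 κ = 1)
    (ha : ∀ n, κ * a n = PowerSeries.C (m n) + PowerSeries.X * a (n + 1))
    (ha' : ∀ n, κ' * a' n = PowerSeries.C (m n) + PowerSeries.X * a' (n + 1)) {N : ℕ}
    (hN : ∀ j < N, PowerSeries.coeff j κ = PowerSeries.coeff j κ') :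
    ∀ j < N, ∀ n, PowerSeries.coeff j (a n) = PowerSeries.coeff j (a' n) := by
  intro j
  induction j using Nat.strong_induction_on with
  | _ j ih =>
    intro hj n
    have h1 : PowerSeries.coeff j (κ * a n) - PowerSeries.coeff j (κ' * a' n) = 0 := by
      rw [ha, ha', map_add, map_add, add_sub_add_left_eq_sub, sub_eq_zero]
      rcases j with _ | j
      · simp
      · rw [PowerSeries.coeff_succ_X_mul, PowerSeries.coeff_succ_X_mul]
        exact ih j (Nat.lt_succ_self j) (by omega) (n + 1)
    rw [PowerSeries.coeff_mul, PowerSeries.coeff_mul, ← Finset.sum_sub_distrib,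
      Finset.sum_eq_single (0, j)] at h1
    · rw [← hN 0 (by omega), hκ0, one_mul, one_mul] at h1
      exact sub_eq_zero.1 h1
    · rintro ⟨p, q⟩ hpq hne
      have hpq' : p + q = j := Finset.HasAntidiagonal.mem_antidiagonal.1 hpq
      have hq : q < j := by
        rcases Nat.eq_zero_or_pos p with rfl | hp
        · exact absurd (by rw [zero_add] at hpq'; rw [hpq']) hne
        · omega
      change PowerSeries.coeff p κ * PowerSeries.coeff q (a n)
        - PowerSeries.coeff p κ' * PowerSeries.coeff q (a' n) = 0
      rw [hN p (by omega), ih q hq (by omega) n, sub_self]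
    · exact fun h => absurd (Finset.HasAntidiagonal.mem_antidiagonal.2 (zero_add j)) h

/-- The moments determine `κ`: since `κ = m_0 + X a_1`, each coefficient of `κ` is given by the
preceding ones. -/
theorem InvertsMoments.series_unique {κ κ' : PowerSeries ℂ} {m : ℕ → ℂ} (hm : m 0 = 1)
    (h : InvertsMoments κ m) (h' : InvertsMoments κ' m) : κ = κ' := by
  have hκ0 := h.coeff_zero
  obtain ⟨a, h0, ha⟩ := h
  obtain ⟨a', h0', ha'⟩ := h'
  have e : κ = PowerSeries.C (m 0) + PowerSeries.X * a 1 := by rw [← ha 0, h0, mul_one]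
  have e' : κ' = PowerSeries.C (m 0) + PowerSeries.X * a' 1 := by rw [← ha' 0, h0', mul_one]
  have all : ∀ N, ∀ j < N, PowerSeries.coeff j κ = PowerSeries.coeff j κ' := by
    intro N
    induction N with
    | zero => intro j hj; omega
    | succ N ih =>
      intro j hj
      rw [e, e', map_add, map_add]
      rcases j with _ | j
      · simp
      · rw [PowerSeries.coeff_succ_X_mul, PowerSeries.coeff_succ_X_mul,
          coeff_eq_of_recursion (hκ0.trans hm) ha ha' ih j (by omega) 1]
  ext j
  exact all (j + 1) j (Nat.lt_succ_self j)

/-- The power series `1 + w R(w) = w K(w)` of a moment sequence. -/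
def kSeries (m : ℕ → ℂ) : PowerSeries ℂ :=
  1 + PowerSeries.X * PowerSeries.mk fun n => freeCumulant m (n + 1)

theorem hasExpansion_rTransform {μ : Measure ℝ} [IsProbabilityMeasure μ] {r : ℝ} (hr : 0 < r)
    (hμ : μ (Set.Icc (-r) r) = 1) :
    HasExpansion (rTransform μ r) (PowerSeries.mk fun n => freeCumulant (moment μ) (n + 1)) := by
  filter_upwards [(isOpen_domV r).mem_nhds (zero_mem_domV hr)] with z hz
  simpa using hasSum_rTransform hr hμ hz

/-- The series `a_n` are the expansions of `h_n(g(w)) / h₀(g(w))`, and `κ` is that of `h₀(g(w))`. -/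
theorem invertsMoments_kSeries {μ : Measure ℝ} [IsProbabilityMeasure μ] {r : ℝ} (hr : 0 < r)
    (hμ : μ (Set.Icc (-r) r) = 1) : InvertsMoments (kSeries (moment μ)) (moment μ) := by
  have h0 := zero_mem_domV hr
  have hne := momentGen_zero_ne_zero hr hμ (gInv_mem hr hμ h0)
  choose a ha using fun n => exists_hasExpansion
    (((analyticOnNhd_momentGen_gInv hr hμ n) 0 h0).div
      ((analyticOnNhd_momentGen_gInv hr hμ 0) 0 h0) hne)
  have hM1 : HasExpansion (fun _ => (1 : ℂ)) 1 := by
    simpa using hasExpansion_const 1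
  have hV := (isOpen_domV r).mem_nhds h0
  refine ⟨a, (ha 0).unique hM1 ?_, fun n => ?_⟩
  · filter_upwards [hV] with w hw
    exact div_self (momentGen_zero_ne_zero hr hμ (gInv_mem hr hμ hw))
  · refine ((hM1.add (hasExpansion_id.mul (hasExpansion_rTransform hr hμ))).mul (ha n)).unique
      ((hasExpansion_const _).add (hasExpansion_id.mul (ha (n + 1)))) ?_
    filter_upwards [hV] with w hw
    have hg := gInv_mem hr hμ hw
    have hne := momentGen_zero_ne_zero hr hμ hg
    have h1 : gInv μ r w * momentGen μ 0 (gInv μ r w) = w := cauchyInv_gInv hr hμ hw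
    have h2 := momentGen_eq hr hμ 0 hg
    have h3 := momentGen_eq hr hμ n hg
    rw [moment_zero, zero_add] at h2
    have h4 : 1 + w * rTransform μ r w = momentGen μ 0 (gInv μ r w) := by
      rw [rTransform_eq hr hμ hw]
      nth_rewrite 1 [← h1]
      rw [mul_assoc, mul_div_cancel₀ _ hne, ← h2]
    have h5 : w * (momentGen μ (n + 1) (gInv μ r w) / momentGen μ 0 (gInv μ r w))
        = gInv μ r w * momentGen μ (n + 1) (gInv μ r w) := by
      nth_rewrite 1 [← h1]
      rw [mul_assoc, mul_div_cancel₀ _ hne]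
    change (1 + w * rTransform μ r w) * (momentGen μ n (gInv μ r w) / momentGen μ 0 (gInv μ r w))
      = moment μ n + w * (momentGen μ (n + 1) (gInv μ r w) / momentGen μ 0 (gInv μ r w))
    rw [h4, h5, ← h3, mul_div_cancel₀ _ hne]

/-! ### Additivity for free random variables -/

section
variable {A : Type*} [Ring A] [Algebra ℂ A]

/-- The span of the products `a₀ ⋯ a_k` of centred elements of `B (i 0), …, B (i k)` with
`i 0 = j` and different neighbouring indices. -/
def alternatingSpan {I : Type*} (φ : A →ₗ[ℂ] ℂ) (B : I → Subalgebra ℂ A) (j : I) :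
    Submodule ℂ A :=
  Submodule.span ℂ {p | ∃ (k : ℕ) (i : Fin (k + 1) → I) (a : Fin (k + 1) → A), i 0 = j ∧
    (∀ l, a l ∈ B (i l)) ∧ (∀ l : Fin k, i l.castSucc ≠ i l.succ) ∧ (∀ l, φ (a l) = 0) ∧
    p = (List.ofFn a).prod}

variable {I : Type*} {φ : A →ₗ[ℂ] ℂ} {B : I → Subalgebra ℂ A}

theorem IsFree.apply_eq_zero (h : IsFree φ B) {j : I} {p : A} (hp : p ∈ alternatingSpan φ B j) :
    φ p = 0 := by
  have : alternatingSpan φ B j ≤ LinearMap.ker φ := by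
    refine Submodule.span_le.2 ?_
    rintro _ ⟨k, i, a, -, h1, h2, h3, rfl⟩
    exact h k i a h1 h2 h3
  exact this hp

theorem mem_alternatingSpan {j : I} {a : A} (ha : a ∈ B j) (h0 : φ a = 0) :
    a ∈ alternatingSpan φ B j :=
  Submodule.subset_span ⟨0, fun _ => j, fun _ => a, rfl, fun _ => ha, fun l => l.elim0,
    fun _ => h0, by simp⟩

theorem mul_mem_alternatingSpan {j l : I} (hjl : j ≠ l) {a p : A} (ha : a ∈ B j) (h0 : φ a = 0)
    (hp : p ∈ alternatingSpan φ B l) : a * p ∈ alternatingSpan φ B j := by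
  induction hp using Submodule.span_induction with
  | mem p hp =>
    obtain ⟨k, i, b, hi, h1, h2, h3, rfl⟩ := hp
    refine Submodule.subset_span ⟨k + 1, Fin.cons j i, Fin.cons a b, rfl, ?_, ?_, ?_, ?_⟩
    · intro t
      refine Fin.cases ?_ (fun t => ?_) t
      · exact ha
      · exact h1 t
    · intro t
      refine Fin.cases ?_ (fun t => ?_) t
      · simpa [hi] using hjl
      · simpa [← Fin.succ_castSucc] using h2 t
    · intro t
      refine Fin.cases ?_ (fun t => ?_) t
      · exact h0
      · exact h3 t
    · rw [List.ofFn_cons, List.prod_cons]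
  | zero => rw [mul_zero]; exact Submodule.zero_mem _
  | add p q _ _ hp hq => rw [mul_add]; exact Submodule.add_mem _ hp hq
  | smul c p _ hp => rw [mul_smul_comm]; exact Submodule.smul_mem _ c hp

/-- The coefficientwise application of `φ` to a power series over `A`. -/
def seriesMap (φ : A →ₗ[ℂ] ℂ) (p : PowerSeries A) : PowerSeries ℂ :=
  PowerSeries.mk fun n => φ (PowerSeries.coeff n p)

theorem coeff_seriesMap (φ : A →ₗ[ℂ] ℂ) (p : PowerSeries A) (n : ℕ) :
    PowerSeries.coeff n (seriesMap φ p) = φ (PowerSeries.coeff n p) := PowerSeries.coeff_mk _ _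

/-- Complex power series as power series over `A`. -/
abbrev scalarSeries (A : Type*) [Ring A] [Algebra ℂ A] : PowerSeries ℂ →+* PowerSeries A :=
  PowerSeries.map (algebraMap ℂ A)

theorem scalarSeries_comm (κ : PowerSeries ℂ) (p : PowerSeries A) :
    scalarSeries A κ * p = p * scalarSeries A κ := by
  ext n
  rw [PowerSeries.coeff_mul, PowerSeries.coeff_mul, ← Finset.Nat.sum_antidiagonal_swap]
  refine Finset.sum_congr rfl fun k _ => ?_
  simp only [Prod.fst_swap, Prod.snd_swap, PowerSeries.coeff_map]
  exact Algebra.commutes _ _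

theorem seriesMap_scalar_mul (φ : A →ₗ[ℂ] ℂ) (κ : PowerSeries ℂ) (p : PowerSeries A) :
    seriesMap φ (scalarSeries A κ * p) = κ * seriesMap φ p := by
  ext n
  rw [coeff_seriesMap, PowerSeries.coeff_mul, PowerSeries.coeff_mul, map_sum]
  refine Finset.sum_congr rfl fun k _ => ?_
  rw [PowerSeries.coeff_map, coeff_seriesMap, ← Algebra.smul_def, map_smul, smul_eq_mul]

/-- The resolvent `V = (κ - w z)⁻¹` of `z` gives a solution of the recursion of `InvertsMoments`. -/
theorem seriesMap_resolvent (φ : A →ₗ[ℂ] ℂ) {κ : PowerSeries ℂ} {z : A} {V : PowerSeries A}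
    (hV : (scalarSeries A κ - PowerSeries.X * PowerSeries.C z) * V = 1) (n : ℕ) :
    κ * seriesMap φ (PowerSeries.C (z ^ n) * V) = PowerSeries.C (φ (z ^ n))
      + PowerSeries.X * seriesMap φ (PowerSeries.C (z ^ (n + 1)) * V) := by
  have h1 : scalarSeries A κ * V = 1 + PowerSeries.X * (PowerSeries.C z * V) := by
    rw [sub_mul, sub_eq_iff_eq_add, mul_assoc] at hV
    exact hV
  have h2 : scalarSeries A κ * (PowerSeries.C (z ^ n) * V)
      = PowerSeries.C (z ^ n) + PowerSeries.X * (PowerSeries.C (z ^ (n + 1)) * V) := by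
    rw [← mul_assoc, scalarSeries_comm, mul_assoc, h1, mul_add, mul_one, ← mul_assoc,
      ← PowerSeries.X_mul, pow_succ, map_mul]
    simp only [mul_assoc]
  rw [← seriesMap_scalar_mul, h2]
  ext j
  rw [coeff_seriesMap, map_add, map_add, map_add]
  congr 1
  · rw [PowerSeries.coeff_C, PowerSeries.coeff_C]
    split_ifs <;> simp
  · rcases j with _ | j
    · simp
    · rw [PowerSeries.coeff_succ_X_mul, PowerSeries.coeff_succ_X_mul, coeff_seriesMap]

/-- The resolvent `U = (κ - w x)⁻¹` has coefficients in the algebra generated by `x`, and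
`φ(U) = 1` expresses `G(K(w)) = w`. -/
theorem exists_resolvent {φ : A →ₗ[ℂ] ℂ} (h1 : φ 1 = 1) {κ : PowerSeries ℂ} {x : A}
    (hκ : InvertsMoments κ fun n => φ (x ^ n)) :
    ∃ U : PowerSeries A, (scalarSeries A κ - PowerSeries.X * PowerSeries.C x) * U = 1 ∧
      (∀ n, PowerSeries.coeff n U ∈ Algebra.adjoin ℂ {x}) ∧ PowerSeries.coeff 0 U = 1 ∧
      seriesMap φ U = 1 := by
  have hκ0 := hκ.coeff_zero
  simp only [pow_zero, h1] at hκ0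
  set S := Algebra.adjoin ℂ {x}
  let xS : S := ⟨x, Algebra.self_mem_adjoin_singleton ℂ x⟩
  let L : PowerSeries S := scalarSeries S κ - PowerSeries.X * PowerSeries.C xS
  have hL0 : PowerSeries.constantCoeff L = ((1 : Sˣ) : S) := by
    rw [← PowerSeries.coeff_zero_eq_constantCoeff_apply]
    simp only [L, map_sub, PowerSeries.coeff_map, hκ0]
    simp
  let ι : PowerSeries S →+* PowerSeries A := PowerSeries.map (S.val : S →+* A)
  have hL : ι L = scalarSeries A κ - PowerSeries.X * PowerSeries.C x := by
    simp only [ι, L, map_sub, map_mul, PowerSeries.map_X, PowerSeries.map_C]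
    congr 1
  have e1 : ι L * ι (PowerSeries.invOfUnit L 1) = 1 := by
    rw [← map_mul, PowerSeries.mul_invOfUnit L 1 hL0, map_one]
  rw [hL] at e1
  refine ⟨ι (PowerSeries.invOfUnit L 1), e1, fun n => ?_, ?_, ?_⟩
  · simp only [ι, PowerSeries.coeff_map]
    exact (PowerSeries.coeff n (PowerSeries.invOfUnit L 1)).2
  · simp [ι]
  · obtain ⟨a, ha0, ha⟩ := hκ
    ext j
    have := coeff_eq_of_recursion hκ0 ha (seriesMap_resolvent φ e1) (N := j + 1)
      (fun _ _ => rfl) j (Nat.lt_succ_self j) 0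
    rw [ha0, pow_zero, map_one PowerSeries.C, one_mul] at this
    exact this.symm

/-- If `x, y` are free and `κ_x = w K_x`, `κ_y = w K_y`, then `κ_x + κ_y - 1 = w K_{x + y}`.

Write `(κ_x - w x)⁻¹ = 1 - E_x` and `(κ_y - w y)⁻¹ = 1 - E_y`, where `E_x, E_y` are centred. Then
`(κ_x + κ_y - 1 - w (x + y))⁻¹ = (1 - E_y) (1 - E_x E_y)⁻¹ (1 - E_x)`, and the expansion of the
right-hand side is `1` plus alternating products of `E_x` and `E_y`, on which `φ` vanishes. -/
theorem InvertsMoments.add_of_free {φ : A →ₗ[ℂ] ℂ} (h1 : φ 1 = 1) {x y : A}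
    (hfree : IsFreeFamily φ ![x, y]) {κx κy : PowerSeries ℂ}
    (hx : InvertsMoments κx fun n => φ (x ^ n)) (hy : InvertsMoments κy fun n => φ (y ^ n)) :
    InvertsMoments (κx + κy - 1) fun n => φ ((x + y) ^ n) := by
  obtain ⟨U, hU1, hUm, hU0, hUφ⟩ := exists_resolvent h1 hx
  obtain ⟨V, hV1, hVm, -, hVφ⟩ := exists_resolvent h1 hy
  set Lx := scalarSeries A κx - PowerSeries.X * PowerSeries.C x with hLx
  set Ly := scalarSeries A κy - PowerSeries.X * PowerSeries.C y with hLy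
  let B : Fin 2 → Subalgebra ℂ A := fun i => Algebra.adjoin ℂ {(![x, y] : Fin 2 → A) i}
  have hB : IsFree φ B := hfree
  set E := 1 - U with hE
  set F := 1 - V with hF
  have centred : ∀ {S : Subalgebra ℂ A} {W : PowerSeries A}, (∀ n, PowerSeries.coeff n W ∈ S) →
      seriesMap φ W = 1 → ∀ n, PowerSeries.coeff n (1 - W) ∈ S ∧
        φ (PowerSeries.coeff n (1 - W)) = 0 := by
    intro S W hW hφ n
    have h2 : φ (PowerSeries.coeff n W) = PowerSeries.coeff n (1 : PowerSeries ℂ) := by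
      rw [← hφ, coeff_seriesMap]
    rw [map_sub, map_sub, h2, PowerSeries.coeff_one, PowerSeries.coeff_one]
    refine ⟨S.sub_mem ?_ (hW n), ?_⟩
    · split_ifs
      · exact S.one_mem
      · exact S.zero_mem
    · split_ifs <;> simp [h1]
  have hEc : ∀ n, PowerSeries.coeff n E ∈ B 0 ∧ φ (PowerSeries.coeff n E) = 0 := centred hUm hUφ
  have hFc : ∀ n, PowerSeries.coeff n F ∈ B 1 ∧ φ (PowerSeries.coeff n F) = 0 := centred hVm hVφ
  have hE0 : PowerSeries.coeff 0 E = 0 := by rw [hE, map_sub, hU0]; simp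
  have hc : PowerSeries.constantCoeff (1 - E * F) = ((1 : Aˣ) : A) := by
    rw [PowerSeries.coeff_zero_eq_constantCoeff_apply] at hE0
    rw [map_sub, map_mul, hE0]
    simp
  set P := PowerSeries.invOfUnit (1 - E * F) 1 * U with hP
  have hPeq : (1 - E * F) * P = U := by
    rw [hP, ← mul_assoc, PowerSeries.mul_invOfUnit _ _ hc, one_mul]
  -- `Q = ∑_{n ≥ 1} (E F)ⁿ (1 - E) - E` consists of alternating products that begin with `E`
  set Q := P - 1 with hQ
  have hQeq : Q = -E + E * F + E * (F * Q) := by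
    have h2 : P = U + E * F * P := by rw [← hPeq]; noncomm_ring
    have h3 : P = 1 + Q := by rw [hQ]; abel
    have h4 : U = 1 - E := by rw [hE]; abel
    calc Q = U + E * F * P - 1 := by rw [← h2]
      _ = 1 - E + E * F * (1 + Q) - 1 := by rw [← h3, ← h4]
      _ = -E + E * F + E * (F * Q) := by noncomm_ring
  have hFQ : ∀ n, (∀ l ≤ n, PowerSeries.coeff l Q ∈ alternatingSpan φ B 0) →
      PowerSeries.coeff n (F * Q) ∈ alternatingSpan φ B 1 := by
    intro n h
    rw [PowerSeries.coeff_mul]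
    refine Submodule.sum_mem _ fun k hk => ?_
    have hk' := Finset.HasAntidiagonal.mem_antidiagonal.1 hk
    exact mul_mem_alternatingSpan (by decide) (hFc _).1 (hFc _).2 (h _ (by omega))
  have hQm : ∀ n, PowerSeries.coeff n Q ∈ alternatingSpan φ B 0 := by
    intro n
    induction n using Nat.strong_induction_on with
    | _ n ih =>
      rw [hQeq, map_add, map_add, map_neg]
      refine Submodule.add_mem _ (Submodule.add_mem _ (Submodule.neg_mem _
        (mem_alternatingSpan (hEc n).1 (hEc n).2)) ?_) ?_
      · rw [PowerSeries.coeff_mul]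
        exact Submodule.sum_mem _ fun k _ => mul_mem_alternatingSpan (by decide) (hEc _).1 (hEc _).2
          (mem_alternatingSpan (hFc _).1 (hFc _).2)
      · rw [PowerSeries.coeff_mul]
        refine Submodule.sum_mem _ fun k hk => ?_
        have hk' := Finset.HasAntidiagonal.mem_antidiagonal.1 hk
        rcases Nat.eq_zero_or_pos k.1 with hk0 | hk0
        · rw [hk0, hE0, zero_mul]
          exact Submodule.zero_mem _
        · exact mul_mem_alternatingSpan (by decide) (hEc _).1 (hEc _).2
            (hFQ _ fun l hl => ih l (by omega))
  have hL : scalarSeries A (κx + κy - 1) - PowerSeries.X * PowerSeries.C (x + y) = Lx + Ly - 1 := by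
    rw [hLx, hLy, map_sub, map_add, map_add, map_one, mul_add]
    abel
  have hres : (scalarSeries A (κx + κy - 1) - PowerSeries.X * PowerSeries.C (x + y)) * (V * P)
      = 1 := by
    have h2 : U + V - U * V = 1 - E * F := by rw [hE, hF]; noncomm_ring
    calc _ = (Lx * V + Ly * V - V) * P := by rw [hL]; noncomm_ring
      _ = (Lx * V + Lx * U - Lx * U * V) * P := by rw [hV1, hU1, one_mul]
      _ = Lx * ((U + V - U * V) * P) := by noncomm_ring
      _ = 1 := by rw [h2, hPeq, hU1]
  refine ⟨_, ?_, fun n => seriesMap_resolvent φ hres n⟩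
  have h3 : V * P = 1 + Q - F - F * Q := by
    have : V = 1 - F := by rw [hF]; abel
    rw [this, hQ]; noncomm_ring
  ext n
  rw [coeff_seriesMap, pow_zero, map_one PowerSeries.C, one_mul, h3]
  simp only [map_sub, map_add]
  rw [hB.apply_eq_zero (hQm n), (hFc n).2, hB.apply_eq_zero (hFQ n fun l _ => hQm l),
    PowerSeries.coeff_one, PowerSeries.coeff_one]
  split_ifs <;> simp [h1]

end

/-! ### Amplification of operators on `ℓ²` -/

/-- The Hilbert space `ℓ²(N)`. -/
abbrev EllTwo (N : Type*) : Type _ := lp (fun _ : N => ℂ) 2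

theorem memℓp_two_iff {N : Type*} {f : N → ℂ} :
    Memℓp f 2 ↔ Summable fun n => ‖f n‖ ^ 2 := by
  rw [memℓp_gen_iff (by norm_num)]
  simp

theorem EllTwo.hasSum_norm_sq {N : Type*} (f : EllTwo N) :
    HasSum (fun n => ‖f n‖ ^ 2) (‖f‖ ^ 2) := by
  have h := lp.hasSum_norm (p := 2) (by norm_num) f
  simpa using h

section Amplification
variable {W V N : Type*} (e : W ≃ V × N)

theorem memℓp_slice (f : EllTwo W) (v : V) : Memℓp (fun n => f (e.symm (v, n))) 2 := by
  rw [memℓp_two_iff]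
  have h := (e.symm.summable_iff).2 (EllTwo.hasSum_norm_sq f).summable
  exact h.comp_injective (i := fun n : N => (v, n)) fun a b h => (Prod.mk.inj h).2

/-- The restriction of `f ∈ ℓ²(V × N)` to the fibre over `v`. -/
def slice (f : EllTwo W) (v : V) : EllTwo N := ⟨fun n => f (e.symm (v, n)), memℓp_slice e f v⟩

@[simp] theorem slice_apply (f : EllTwo W) (v : V) (n : N) :
    slice e f v n = f (e.symm (v, n)) := rfl

theorem hasSum_norm_slice (f : EllTwo W) : HasSum (fun v => ‖slice e f v‖ ^ 2) (‖f‖ ^ 2) := by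
  have h := (e.symm.hasSum_iff).2 (EllTwo.hasSum_norm_sq f)
  exact h.prod_fiberwise fun v => EllTwo.hasSum_norm_sq (slice e f v)

theorem hasSum_inner_slice (f g : EllTwo W) :
    HasSum (fun v => inner ℂ (slice e f v) (slice e g v)) (inner ℂ f g) := by
  have h := (e.symm.hasSum_iff).2 (lp.hasSum_inner (𝕜 := ℂ) f g)
  exact h.prod_fiberwise fun v => lp.hasSum_inner (𝕜 := ℂ) (slice e f v) (slice e g v)

theorem memℓp_amplify (T : EllTwo N →L[ℂ] EllTwo N) (f : EllTwo W) :
    Memℓp (fun w => T (slice e f (e w).1) (e w).2) 2 := by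
  rw [memℓp_two_iff, ← e.symm.summable_iff]
  refine (summable_prod_of_nonneg fun _ => sq_nonneg _).2 ?_
  simp only [Equiv.apply_symm_apply]
  refine ⟨fun v => (EllTwo.hasSum_norm_sq _).summable, ?_⟩
  simp_rw [fun v => (EllTwo.hasSum_norm_sq (T (slice e f v))).tsum_eq]
  refine Summable.of_nonneg_of_le (fun _ => by positivity) (fun v => ?_)
    ((hasSum_norm_slice e f).summable.mul_left (‖T‖ ^ 2))
  rw [← mul_pow]
  gcongr
  exact T.le_opNorm _

/-- The action of `T` on each fibre of `f`. -/
def amplifyFun (T : EllTwo N →L[ℂ] EllTwo N) (f : EllTwo W) : EllTwo W :=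
  ⟨fun w => T (slice e f (e w).1) (e w).2, memℓp_amplify e T f⟩

theorem slice_amplifyFun (T : EllTwo N →L[ℂ] EllTwo N) (f : EllTwo W) (v : V) :
    slice e (amplifyFun e T f) v = T (slice e f v) := by
  ext n
  change T (slice e f (e (e.symm (v, n))).1) (e (e.symm (v, n))).2 = _
  rw [Equiv.apply_symm_apply]

theorem slice_ext {f g : EllTwo W} (h : ∀ v, slice e f v = slice e g v) : f = g := by
  ext w
  have := congrArg (fun s : EllTwo N => s (e w).2) (h (e w).1)
  simpa using this

theorem slice_add (f g : EllTwo W) (v : V) : slice e (f + g) v = slice e f v + slice e g v := rfl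

theorem slice_smul (c : ℂ) (f : EllTwo W) (v : V) : slice e (c • f) v = c • slice e f v := rfl

theorem norm_amplifyFun_le (T : EllTwo N →L[ℂ] EllTwo N) (f : EllTwo W) :
    ‖amplifyFun e T f‖ ≤ ‖T‖ * ‖f‖ := by
  refine le_of_sq_le_sq ?_ (by positivity)
  rw [mul_pow]
  refine hasSum_le (fun v => ?_) (hasSum_norm_slice e (amplifyFun e T f))
    ((hasSum_norm_slice e f).mul_left (‖T‖ ^ 2))
  rw [slice_amplifyFun, ← mul_pow]
  gcongr
  exact T.le_opNorm _

/-- The operator `1 ⊗ T` on `ℓ²(V × N) = ℓ²(V) ⊗ ℓ²(N)`. -/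
def amplifyCLM (T : EllTwo N →L[ℂ] EllTwo N) : EllTwo W →L[ℂ] EllTwo W :=
  LinearMap.mkContinuous
    { toFun := amplifyFun e T
      map_add' := fun f g => slice_ext e fun v => by
        simp only [slice_amplifyFun, slice_add, map_add]
      map_smul' := fun c f => slice_ext e fun v => by
        simp only [slice_amplifyFun, slice_smul, map_smul, RingHom.id_apply] }
    ‖T‖ (norm_amplifyFun_le e T)

theorem slice_amplifyCLM (T : EllTwo N →L[ℂ] EllTwo N) (f : EllTwo W) (v : V) :
    slice e (amplifyCLM e T f) v = T (slice e f v) := slice_amplifyFun e T f v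

/-- `T ↦ 1 ⊗ T` as a homomorphism of algebras. -/
def amplify : (EllTwo N →L[ℂ] EllTwo N) →ₐ[ℂ] (EllTwo W →L[ℂ] EllTwo W) :=
  AlgHom.ofLinearMap
    { toFun := amplifyCLM e
      map_add' := fun S T => by
        ext1 f
        refine slice_ext e fun v => ?_
        rw [add_apply, slice_add]
        simp only [slice_amplifyCLM, add_apply]
      map_smul' := fun c T => by
        ext1 f
        refine slice_ext e fun v => ?_
        rw [RingHom.id_apply, smul_apply, slice_smul]
        simp only [slice_amplifyCLM, smul_apply] }
    (by
      ext1 f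
      refine slice_ext e fun v => ?_
      exact slice_amplifyCLM e 1 f v)
    (fun S T => by
      ext1 f
      refine slice_ext e fun v => ?_
      change slice e (amplifyCLM e (S * T) f) v = slice e (amplifyCLM e S (amplifyCLM e T f)) v
      simp only [slice_amplifyCLM, mul_apply_eq_comp])

theorem slice_amplify (T : EllTwo N →L[ℂ] EllTwo N) (f : EllTwo W) (v : V) :
    slice e (amplify e T f) v = T (slice e f v) := slice_amplifyFun e T f v

theorem amplify_apply (T : EllTwo N →L[ℂ] EllTwo N) (f : EllTwo W) (w : W) :
    amplify e T f w = T (slice e f (e w).1) (e w).2 := rfl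

theorem isSelfAdjoint_amplify {T : EllTwo N →L[ℂ] EllTwo N} (hT : IsSelfAdjoint T) :
    IsSelfAdjoint (amplify e T) := by
  rw [ContinuousLinearMap.isSelfAdjoint_iff_isSymmetric] at hT ⊢
  intro f g
  have h : (fun v => inner ℂ (slice e (amplify e T f) v) (slice e g v))
      = fun v => inner ℂ (slice e f v) (slice e (amplify e T g) v) := by
    funext v
    rw [slice_amplify, slice_amplify]
    exact hT _ _
  have h1 := hasSum_inner_slice e (amplify e T f) g
  rw [h] at h1
  exact h1.unique (hasSum_inner_slice e f (amplify e T g))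

end Amplification

/-! ### The free product of pointed Hilbert spaces -/

section FreeProduct
open Monoid.CoprodI

variable {ι : Type*} {M : ι → Type*} [∀ i, Monoid (M i)] [DecidableEq ι] [∀ i, DecidableEq (M i)]

/-- A reduced word is a letter of `M i`, possibly trivial, followed by a word that does not begin
with a letter of `M i`. -/
def wordEquiv (i : ι) : Word M ≃ {w : Word M // w.fstIdx ≠ some i} × M i :=
  (Word.equivPair i).trans
    { toFun := fun p => (⟨p.tail, p.fstIdx_ne⟩, p.head)
      invFun := fun q => ⟨q.2, q.1.1, q.1.2⟩
      left_inv := fun _ => rfl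
      right_inv := fun _ => rfl }

theorem wordEquiv_of_ne {i : ι} {w : Word M} (h : w.fstIdx ≠ some i) :
    wordEquiv i w = (⟨w, h⟩, 1) := by
  simp [wordEquiv, Word.equivPair_eq_of_fstIdx_ne h]

theorem wordEquiv_symm_one {i : ι} (v : {w : Word M // w.fstIdx ≠ some i}) :
    (wordEquiv i).symm (v, 1) = v.1 := by
  rw [Equiv.symm_apply_eq, wordEquiv_of_ne v.2]

theorem fstIdx_wordEquiv_symm {i : ι} (v : {w : Word M // w.fstIdx ≠ some i}) {m : M i}
    (hm : m ≠ 1) : ((wordEquiv i).symm (v, m)).fstIdx = some i := by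
  by_contra h
  have h1 := wordEquiv_of_ne h
  rw [Equiv.apply_symm_apply] at h1
  exact hm (Prod.mk.inj h1).2

/-- The functional `T ↦ ⟨e₀, T e₀⟩` on the bounded operators on `ℓ²(N)`. -/
def vectorState {N : Type*} [DecidableEq N] (n₀ : N) : (EllTwo N →L[ℂ] EllTwo N) →ₗ[ℂ] ℂ where
  toFun T := T (lp.single 2 n₀ 1) n₀
  map_add' _ _ := rfl
  map_smul' _ _ := rfl

theorem vectorState_apply {N : Type*} [DecidableEq N] (n₀ : N) (T : EllTwo N →L[ℂ] EllTwo N) :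
    vectorState n₀ T = T (lp.single 2 n₀ 1) n₀ := rfl

theorem vectorState_eq_inner {N : Type*} [DecidableEq N] (n₀ : N) (T : EllTwo N →L[ℂ] EllTwo N) :
    vectorState n₀ T = inner ℂ (lp.single 2 n₀ (1 : ℂ)) (T (lp.single 2 n₀ 1)) := by
  rw [lp.inner_single_left, vectorState_apply]
  simp

theorem vectorState_one {N : Type*} [DecidableEq N] (n₀ : N) : vectorState n₀ 1 = 1 := by
  rw [vectorState_apply, one_apply_eq_self, lp.single_apply_self]

theorem isState_vectorState {N : Type*} [DecidableEq N] (n₀ : N) : IsState (vectorState n₀) := by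
  have h : ∀ a : EllTwo N →L[ℂ] EllTwo N, vectorState n₀ (star a * a)
      = ((‖a (lp.single 2 n₀ (1 : ℂ))‖ ^ 2 : ℝ) : ℂ) := by
    intro a
    rw [vectorState_eq_inner, mul_apply_eq_comp, ContinuousLinearMap.star_eq_adjoint,
      ContinuousLinearMap.adjoint_inner_right, inner_self_eq_norm_sq_to_K]
    simp
  refine ⟨vectorState_one n₀, fun a => ?_, fun a => ?_⟩
  · rw [h, Complex.ofReal_re]
    positivity
  · rw [h, Complex.ofReal_im]

/-- The action of operators on `ℓ²(M i)` on the free product `ℓ²(Word M)`, by acting on the first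
letter. -/
abbrev freeAction (i : ι) : (EllTwo (M i) →L[ℂ] EllTwo (M i)) →ₐ[ℂ]
    (EllTwo (Word M) →L[ℂ] EllTwo (Word M)) :=
  amplify (wordEquiv i)

theorem slice_of_support {i : ι} {f : EllTwo (Word M)}
    (hf : ∀ w : Word M, w.fstIdx = some i → f w = 0) (v : {w : Word M // w.fstIdx ≠ some i}) :
    slice (wordEquiv i) f v = f v.1 • lp.single 2 (1 : M i) (1 : ℂ) := by
  ext m
  rw [slice_apply, lp.coeFn_smul, Pi.smul_apply, smul_eq_mul]
  by_cases hm : m = 1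
  · rw [hm, wordEquiv_symm_one, lp.single_apply_self, mul_one]
  · rw [hf _ (fstIdx_wordEquiv_symm v hm), lp.single_apply_ne _ _ _ hm, mul_zero]

/-- A centred operator on the `i`-th factor maps vectors supported on words not beginning in `M i`
to vectors supported on words beginning in `M i`. -/
theorem freeAction_support {i : ι} {T : EllTwo (M i) →L[ℂ] EllTwo (M i)}
    (hT : vectorState 1 T = 0) {f : EllTwo (Word M)}
    (hf : ∀ w : Word M, w.fstIdx = some i → f w = 0) {w : Word M} (hw : w.fstIdx ≠ some i) :
    freeAction i T f w = 0 := by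
  rw [amplify_apply, wordEquiv_of_ne hw, slice_of_support hf, map_smul, lp.coeFn_smul,
    Pi.smul_apply, smul_eq_mul, ← vectorState_apply, hT, mul_zero]

theorem single_empty_apply {w : Word M} {i : ι} (hw : w.fstIdx = some i) :
    (lp.single 2 (Word.empty : Word M) (1 : ℂ) : EllTwo (Word M)) w = 0 := by
  rw [lp.single_apply_ne]
  rintro rfl
  cases hw

theorem vectorState_freeAction (i : ι) (T : EllTwo (M i) →L[ℂ] EllTwo (M i)) :
    vectorState Word.empty (freeAction i T) = vectorState 1 T := by
  have hw : (Word.empty : Word M).fstIdx ≠ some i := by rintro ⟨⟩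
  rw [vectorState_apply, amplify_apply, wordEquiv_of_ne hw,
    slice_of_support fun w hw => single_empty_apply hw, lp.single_apply_self, one_smul,
    vectorState_apply]

/-- Centred operators of alternating factors take the empty word to words that begin with a letter
of the first factor, hence to a vector orthogonal to the empty word. -/
theorem isFree_range_freeAction :
    IsFree (vectorState Word.empty) fun i : ι => (freeAction (M := M) i).range := by
  have key : ∀ (k : ℕ) (i : Fin (k + 1) → ι)
      (a : Fin (k + 1) → (EllTwo (Word M) →L[ℂ] EllTwo (Word M))),
      (∀ j, a j ∈ (freeAction (M := M) (i j)).range) → (∀ j : Fin k, i j.castSucc ≠ i j.succ) →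
      (∀ j, vectorState Word.empty (a j) = 0) → ∀ w : Word M, w.fstIdx ≠ some (i 0) →
        (List.ofFn a).prod (lp.single 2 Word.empty (1 : ℂ)) w = 0 := by
    intro k
    induction k with
    | zero =>
      intro i a ha _ h0 w hw
      obtain ⟨T, hT⟩ := ha 0
      have h1 := h0 0
      have hT' : freeAction (i 0) T = a 0 := hT
      rw [← hT', vectorState_freeAction] at h1
      simp only [List.ofFn_succ, List.ofFn_zero, List.prod_cons, List.prod_nil, mul_one]
      rw [← hT']
      exact freeAction_support h1 (fun w hw => single_empty_apply hw) hw
    | succ k ih =>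
      intro i a ha hi h0 w hw
      obtain ⟨T, hT⟩ := ha 0
      have h1 := h0 0
      have hT' : freeAction (i 0) T = a 0 := hT
      rw [← hT', vectorState_freeAction] at h1
      rw [List.ofFn_succ, List.prod_cons, ← hT', mul_apply_eq_comp]
      refine freeAction_support h1 (fun u hu => ?_) hw
      refine ih (fun j => i j.succ) (fun j => a j.succ) (fun j => ha j.succ)
        (fun j => ?_) (fun j => h0 j.succ) u ?_
      · rw [Fin.succ_castSucc]
        exact hi j.succ
      · rw [hu]
        intro h
        exact hi 0 (by simpa using Option.some.inj h)
  intro k i a ha hi h0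
  exact key k i a ha hi h0 Word.empty (by rintro ⟨⟩)

end FreeProduct

/-! ### Distributions of bounded self-adjoint operators -/

section Distribution
variable {H : Type*} [NormedAddCommGroup H] [InnerProductSpace ℂ H] [CompleteSpace H]

/-- The functional `f ↦ ⟨Ω, f(T) Ω⟩` on the continuous functions on the spectrum of `T`. -/
def spectralFunctional {T : H →L[ℂ] H} (hT : IsSelfAdjoint T) (Ω : H) :
    CompactlySupportedContinuousMap (spectrum ℝ T) ℝ →ₗ[ℝ] ℝ where
  toFun f := (inner ℂ Ω (cfcHom (R := ℝ) hT f.toContinuousMap Ω)).re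
  map_add' f g := by
    have h : (f + g).toContinuousMap = f.toContinuousMap + g.toContinuousMap := rfl
    rw [h, map_add, add_apply, inner_add_right, Complex.add_re]
  map_smul' c f := by
    have h : (c • f).toContinuousMap = c • f.toContinuousMap := rfl
    rw [h, map_smul, smul_apply, inner_smul_right_eq_smul, Complex.smul_re, RingHom.id_apply]

theorem spectralFunctional_nonneg {T : H →L[ℂ] H} (hT : IsSelfAdjoint T) (Ω : H)
    (f : CompactlySupportedContinuousMap (spectrum ℝ T) ℝ) (hf : 0 ≤ f) :
    0 ≤ spectralFunctional hT Ω f := by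
  let g : C(spectrum ℝ T, ℝ) := ⟨fun x => √(f x), f.continuous.sqrt⟩
  have hg : f.toContinuousMap = star g * g := by
    ext x
    exact (Real.mul_self_sqrt (hf x)).symm
  change 0 ≤ (inner ℂ Ω (cfcHom (R := ℝ) hT f.toContinuousMap Ω)).re
  rw [hg, map_mul, map_star, mul_apply_eq_comp, ContinuousLinearMap.star_eq_adjoint,
    ContinuousLinearMap.adjoint_inner_right]
  exact inner_self_nonneg (𝕜 := ℂ)

/-- A bounded self-adjoint operator has a distribution in a vector state. -/
theorem exists_isDistribution {T : H →L[ℂ] H} (hT : IsSelfAdjoint T) {Ω : H} (hΩ : ‖Ω‖ = 1)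
    {φ : (H →L[ℂ] H) →ₗ[ℂ] ℂ} (hφ : ∀ S, φ S = inner ℂ Ω (S Ω)) :
    ∃ ρ : Measure ℝ, IsDistribution φ T ρ := by
  let Λ := PositiveLinearMap.mk₀ (spectralFunctional hT Ω) (spectralFunctional_nonneg hT Ω)
  let ρ₀ := RealRMK.rieszMeasure Λ
  have hint : ∀ f : C(spectrum ℝ T, ℝ), ∫ x, f x ∂ρ₀ = (inner ℂ Ω (cfcHom (R := ℝ) hT f Ω)).re :=
    fun f => RealRMK.integral_rieszMeasure Λ (CompactlySupportedContinuousMap.continuousMapEquiv f)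
  have huniv : ρ₀ Set.univ = 1 := by
    have h := hint 1
    rw [map_one, one_apply_eq_self, inner_self_eq_norm_sq_to_K, hΩ] at h
    simp only [ContinuousMap.one_apply, integral_const, smul_eq_mul, mul_one] at h
    have h2 : (ρ₀ Set.univ).toReal = 1 := by simpa [Measure.real] using h
    exact (ENNReal.toReal_eq_one_iff _).1 h2
  have hmeas : Measurable (Subtype.val : spectrum ℝ T → ℝ) := measurable_subtype_coe
  have hemb : MeasurableEmbedding (Subtype.val : spectrum ℝ T → ℝ) :=
    MeasurableEmbedding.subtype_coe (spectrum.isClosed (𝕜 := ℝ) T).measurableSet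
  refine ⟨ρ₀.map Subtype.val, ⟨by rw [Measure.map_apply hmeas MeasurableSet.univ]; exact huniv⟩,
    ?_, fun n => ?_⟩
  · obtain ⟨M, hM⟩ := (spectrum.isBounded (𝕜 := ℝ) T).exists_norm_le
    refine ⟨|M| + 1, by positivity, ?_⟩
    rw [Measure.map_apply hmeas measurableSet_Icc, ← huniv]
    congr 1
    refine Set.eq_univ_of_forall fun x => abs_le.1 ?_
    have h1 := hM x.1 x.2
    rw [Real.norm_eq_abs] at h1
    have h2 := le_abs_self M
    linarith
  · have hpow : cfcHom (R := ℝ) hT (((ContinuousMap.id ℝ).restrict (spectrum ℝ T)) ^ n) = T ^ n := by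
      rw [map_pow, cfcHom_id]
    have h1 := hint (((ContinuousMap.id ℝ).restrict (spectrum ℝ T)) ^ n)
    rw [hpow] at h1
    rw [moment, hemb.integral_map]
    have h2 : ∫ x : spectrum ℝ T, (x : ℝ) ^ n ∂ρ₀ = (inner ℂ Ω ((T ^ n) Ω)).re := h1
    rw [h2, hφ]
    refine Complex.ext (by simp) ?_
    have hs := ContinuousLinearMap.isSelfAdjoint_iff_isSymmetric.1 (hT.pow n)
    have h3 : (starRingEnd ℂ) (inner ℂ Ω ((T ^ n) Ω)) = inner ℂ Ω ((T ^ n) Ω) := by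
      rw [inner_conj_symm]
      exact hs Ω Ω
    rw [Complex.conj_eq_iff_im.1 h3, Complex.ofReal_im]

end Distribution

/-! ### Compactly supported measures are determined by their moments -/

/-- By the Weierstrass theorem, the moments determine the integrals of continuous functions. -/
theorem eq_of_moment_eq {μ ν : Measure ℝ} [IsProbabilityMeasure μ] [IsProbabilityMeasure ν] {M : ℝ}
    (hμ : μ (Set.Icc (-M) M) = 1) (hν : ν (Set.Icc (-M) M) = 1)
    (h : ∀ n, moment μ n = moment ν n) : μ = ν := by
  have hint : ∀ (μ : Measure ℝ) [IsProbabilityMeasure μ], μ (Set.Icc (-M) M) = 1 →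
      ∀ p : Polynomial ℝ, Integrable (fun t => p.eval t) μ := by
    intro μ _ hμ p
    obtain ⟨C, hC⟩ := isCompact_Icc.exists_bound_of_continuousOn
      (s := Set.Icc (-M) M) p.continuous.continuousOn
    refine Integrable.of_bound p.continuous.aestronglyMeasurable C ?_
    filter_upwards [ae_abs_le hμ] with t ht
    exact hC t (abs_le.1 ht)
  have hpow : ∀ n, ∫ t, t ^ n ∂μ = ∫ t, t ^ n ∂ν := fun n => Complex.ofReal_injective (h n)
  have hpoly : ∀ p : Polynomial ℝ, ∫ t, p.eval t ∂μ = ∫ t, p.eval t ∂ν := by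
    intro p
    have hX : ∀ (μ : Measure ℝ) [IsProbabilityMeasure μ], μ (Set.Icc (-M) M) = 1 →
        ∫ t, p.eval t ∂μ = ∑ i ∈ Finset.range (p.natDegree + 1), p.coeff i * ∫ t, t ^ i ∂μ := by
      intro μ _ hμ
      simp_rw [Polynomial.eval_eq_sum_range]
      rw [integral_finsetSum _ fun i _ => ?_]
      · simp_rw [integral_const_mul]
      · have := hint μ hμ (Polynomial.X ^ i)
        simp only [Polynomial.eval_pow, Polynomial.eval_X] at this
        exact this.const_mul _
    rw [hX μ hμ, hX ν hν]
    simp_rw [hpow]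
  refine ext_of_forall_integral_eq_of_IsFiniteMeasure fun f => ?_
  refine eq_of_forall_dist_le fun ε hε => ?_
  rw [Real.dist_eq]
  obtain ⟨p, hp⟩ := exists_polynomial_near_of_continuousOn (-M) M f f.continuous.continuousOn
    (ε / 2) (by positivity)
  have hclose : ∀ (μ : Measure ℝ) [IsProbabilityMeasure μ], μ (Set.Icc (-M) M) = 1 →
      |∫ t, p.eval t ∂μ - ∫ t, f t ∂μ| ≤ ε / 2 := by
    intro μ _ hμ
    rw [← integral_sub (hint μ hμ p) (f.integrable μ), ← Real.norm_eq_abs]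
    refine (norm_integral_le_of_norm_le_const (C := ε / 2) ?_).trans (by simp)
    filter_upwards [ae_abs_le hμ] with t ht
    exact (hp t (abs_le.1 ht)).le
  have h1 := hclose μ hμ
  have h2 := hclose ν hν
  rw [hpoly p] at h1
  rw [abs_le] at h1 h2 ⊢
  constructor <;> linarith

/-! ### The multiplication operator on `L²(μ)` -/

section Multiplication
variable {μ : Measure ℝ} [IsProbabilityMeasure μ] {r : ℝ}

theorem memLp_top_id (hμ : μ (Set.Icc (-r) r) = 1) : MemLp (fun t : ℝ => (t : ℂ)) ⊤ μ :=
  memLp_top_of_bound Complex.continuous_ofReal.aestronglyMeasurable r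
    ((ae_abs_le hμ).mono fun t ht => by rwa [Complex.norm_real])

/-- Multiplication by the independent variable on `L²(μ)`, for `μ` of bounded support. -/
def mulOp (hμ : μ (Set.Icc (-r) r) = 1) : Lp ℂ 2 μ →L[ℂ] Lp ℂ 2 μ :=
  LinearMap.mkContinuous
    { toFun := fun g => ((memLp_top_id hμ).toLp _ : Lp ℂ ⊤ μ) • g
      map_add' := fun _ _ => Lp.add_smul _ _ _
      map_smul' := fun c f => (Lp.smul_comm c _ f).symm }
    ‖((memLp_top_id hμ).toLp _ : Lp ℂ ⊤ μ)‖ (fun g => Lp.norm_smul_le _ g)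

theorem coeFn_mulOp (hμ : μ (Set.Icc (-r) r) = 1) (g : Lp ℂ 2 μ) :
    mulOp hμ g =ᵐ[μ] fun t => (t : ℂ) * g t := by
  filter_upwards [Lp.coeFn_lpSMul (r := 2) ((memLp_top_id hμ).toLp _ : Lp ℂ ⊤ μ) g,
    (memLp_top_id hμ).coeFn_toLp] with t h1 h2
  change (((memLp_top_id hμ).toLp _ : Lp ℂ ⊤ μ) • g : Lp ℂ 2 μ) t = _
  rw [h1, Pi.smul_apply', h2, smul_eq_mul]

theorem isSelfAdjoint_mulOp (hμ : μ (Set.Icc (-r) r) = 1) : IsSelfAdjoint (mulOp hμ) := by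
  rw [ContinuousLinearMap.isSelfAdjoint_iff_isSymmetric]
  intro f g
  change inner ℂ (mulOp hμ f) g = inner ℂ f (mulOp hμ g)
  rw [L2.inner_def, L2.inner_def]
  refine integral_congr_ae ?_
  filter_upwards [coeFn_mulOp hμ f, coeFn_mulOp hμ g] with t h1 h2
  rw [h1, h2]
  simp only [RCLike.inner_apply, map_mul, Complex.conj_ofReal]
  ring

/-- The constant function `1` in `L²(μ)`. -/
def oneVec (μ : Measure ℝ) [IsProbabilityMeasure μ] : Lp ℂ 2 μ :=
  (memLp_const (1 : ℂ)).toLp _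

theorem coeFn_oneVec : oneVec μ =ᵐ[μ] fun _ => (1 : ℂ) := (memLp_const (1 : ℂ)).coeFn_toLp

theorem coeFn_mulOp_pow (hμ : μ (Set.Icc (-r) r) = 1) (n : ℕ) :
    (mulOp hμ ^ n) (oneVec μ) =ᵐ[μ] fun t => (t : ℂ) ^ n := by
  induction n with
  | zero => simpa using coeFn_oneVec
  | succ n ih =>
    rw [pow_succ', mul_apply_eq_comp]
    filter_upwards [coeFn_mulOp hμ ((mulOp hμ ^ n) (oneVec μ)), ih] with t h1 h2
    rw [h1, h2, pow_succ']

theorem inner_oneVec_mulOp_pow (hμ : μ (Set.Icc (-r) r) = 1) (n : ℕ) :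
    inner ℂ (oneVec μ) ((mulOp hμ ^ n) (oneVec μ)) = moment μ n := by
  rw [L2.inner_def, moment_eq_integral]
  refine integral_congr_ae ?_
  filter_upwards [coeFn_mulOp_pow hμ n, coeFn_oneVec] with t h1 h2
  rw [h1, h2]
  simp

/-- A monoid structure on `N` with a given unit `n₀`, in which the product of two other elements is
the left one. It serves only to mark the point `n₀`, so that reduced words over pointed sets become
reduced words over monoids. -/
abbrev pointedMonoid {N : Type*} [DecidableEq N] (n₀ : N) : Monoid N where
  mul a b := if a = n₀ then b else a
  one := n₀
  mul_assoc a b c := by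
    change (if (if a = n₀ then b else a) = n₀ then c else if a = n₀ then b else a)
      = if a = n₀ then (if b = n₀ then c else b) else a
    by_cases h : a = n₀ <;> simp [h]
  one_mul a := if_pos rfl
  mul_one a := by
    change (if a = n₀ then n₀ else a) = a
    split_ifs with h
    · exact h.symm
    · rfl

/-- Every compactly supported probability measure is the distribution, in a vector state given by a
basis vector, of a bounded self-adjoint operator on some `ℓ²(N)`. -/
theorem exists_operator_model (hμ : μ (Set.Icc (-r) r) = 1) :
    ∃ (N : Type) (_ : Monoid N) (_ : DecidableEq N) (J : EllTwo N →L[ℂ] EllTwo N),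
      IsSelfAdjoint J ∧ ∀ n, vectorState 1 (J ^ n) = moment μ n := by
  classical
  have hnorm : ‖oneVec μ‖ = 1 := by
    have h := inner_oneVec_mulOp_pow hμ 0
    rw [pow_zero, one_apply_eq_self, moment_zero, inner_self_eq_norm_sq_to_K] at h
    have h' : ((‖oneVec μ‖ ^ 2 : ℝ) : ℂ) = 1 := by
      rw [Complex.ofReal_pow]
      exact h
    exact (pow_eq_one_iff_of_nonneg (norm_nonneg _) two_ne_zero).1 (by exact_mod_cast h')
  have horth : Orthonormal ℂ (Subtype.val : ({oneVec μ} : Set (Lp ℂ 2 μ)) → Lp ℂ 2 μ) := by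
    refine ⟨fun v => by rw [show v.1 = oneVec μ from v.2]; exact hnorm, fun v w hvw => ?_⟩
    exact absurd (Subtype.ext ((show v.1 = oneVec μ from v.2).trans
      (show w.1 = oneVec μ from w.2).symm)) hvw
  obtain ⟨N, b, hN, hb⟩ := horth.exists_hilbertBasis_extension
  have h1N : oneVec μ ∈ N := hN rfl
  let U := b.repr
  have hU : U (oneVec μ) = lp.single 2 (⟨oneVec μ, h1N⟩ : N) (1 : ℂ) := by
    rw [← b.repr_self, hb]
  let Φ := LinearIsometryEquiv.conjStarAlgEquiv U
  have hΦ : ∀ (S : Lp ℂ 2 μ →L[ℂ] Lp ℂ 2 μ) v, Φ S v = U (S (U.symm v)) := fun _ _ => rfl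
  refine ⟨N, pointedMonoid ⟨oneVec μ, h1N⟩, inferInstance, Φ (mulOp hμ), ?_, fun n => ?_⟩
  · exact (isSelfAdjoint_mulOp hμ).map Φ
  · change vectorState (⟨oneVec μ, h1N⟩ : N) _ = _
    rw [← map_pow, vectorState_eq_inner, hΦ, ← hU, U.symm_apply_apply, U.inner_map_map,
      inner_oneVec_mulOp_pow]

end Multiplication

/-! ### Existence of the free convolution -/

/-- The operators of the models of `μ` and `ν`, acting on the free product of their spaces, are free
with distributions `μ` and `ν`. -/
theorem exists_isFreeConvolution {μ ν : Measure ℝ} [IsProbabilityMeasure μ]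
    [IsProbabilityMeasure ν] {r₁ r₂ : ℝ} (h₁ : 0 < r₁) (h₂ : 0 < r₂)
    (hμ : μ (Set.Icc (-r₁) r₁) = 1) (hν : ν (Set.Icc (-r₂) r₂) = 1) :
    ∃ ρ, IsFreeConvolution μ ν ρ := by
  let μs : Fin 2 → Measure ℝ := ![μ, ν]
  have hμs : ∀ i, ∃ (N : Type) (_ : Monoid N) (_ : DecidableEq N) (J : EllTwo N →L[ℂ] EllTwo N),
      IsSelfAdjoint J ∧ ∀ n, vectorState 1 (J ^ n) = moment (μs i) n := by
    intro i
    fin_cases i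
    · exact exists_operator_model (μ := μ) hμ
    · exact exists_operator_model (μ := ν) hν
  choose N _ _ J hJ hm using hμs
  let W := Monoid.CoprodI.Word N
  let x : Fin 2 → (EllTwo W →L[ℂ] EllTwo W) := fun i => freeAction (M := N) i (J i)
  let φ : (EllTwo W →L[ℂ] EllTwo W) →ₗ[ℂ] ℂ := vectorState (Monoid.CoprodI.Word.empty : W)
  have hx : ∀ i, IsSelfAdjoint (x i) := fun i => isSelfAdjoint_amplify _ (hJ i)
  have hmx : ∀ i n, φ (x i ^ n) = moment (μs i) n := fun i n => by
    simp only [φ, x]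
    rw [← hm i n, ← map_pow]
    exact vectorState_freeAction (M := N) i (J i ^ n)
  have hΩ : ‖(lp.single 2 (Monoid.CoprodI.Word.empty : W) (1 : ℂ) : EllTwo W)‖ = 1 := by
    rw [lp.norm_single (by norm_num), norm_one]
  obtain ⟨ρ, hρ⟩ := exists_isDistribution ((hx 0).add (hx 1)) hΩ (φ := φ)
    fun S => vectorState_eq_inner _ S
  have hfree : IsFreeFamily φ ![x 0, x 1] := by
    intro k i a ha hi h0
    refine isFree_range_freeAction (M := N) k i a (fun j => ?_) hi h0
    refine Algebra.adjoin_le ?_ (ha j)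
    rw [Set.singleton_subset_iff]
    generalize i j = l
    fin_cases l
    · exact ⟨J 0, rfl⟩
    · exact ⟨J 1, rfl⟩
  exact ⟨ρ, EllTwo W →L[ℂ] EllTwo W, inferInstance, inferInstance, inferInstance, inferInstance,
    φ, x 0, x 1, isState_vectorState _, hx 0, hx 1, ⟨inferInstance, ⟨r₁, h₁, hμ⟩, hmx 0⟩,
    ⟨inferInstance, ⟨r₂, h₂, hν⟩, hmx 1⟩, hfree, hρ⟩

/-! ### The free convolution -/

/-- The moments of any free convolution of `μ` and `ν` are determined by `κ_μ + κ_ν - 1`. -/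
theorem IsFreeConvolution.invertsMoments {μ ν ρ : Measure ℝ} [IsProbabilityMeasure μ]
    [IsProbabilityMeasure ν] {r₁ r₂ : ℝ} (h₁ : 0 < r₁) (h₂ : 0 < r₂)
    (hμ : μ (Set.Icc (-r₁) r₁) = 1) (hν : ν (Set.Icc (-r₂) r₂) = 1)
    (h : IsFreeConvolution μ ν ρ) :
    InvertsMoments (kSeries (moment μ) + kSeries (moment ν) - 1) (moment ρ) := by
  obtain ⟨A, _, _, _, _, φ, x, y, hφ, -, -, hx, hy, hfree, hxy⟩ := h
  have hxI : InvertsMoments (kSeries (moment μ)) fun n => φ (x ^ n) := by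
    rw [show (fun n => φ (x ^ n)) = moment μ from funext hx.moments]
    exact invertsMoments_kSeries h₁ hμ
  have hyI : InvertsMoments (kSeries (moment ν)) fun n => φ (y ^ n) := by
    rw [show (fun n => φ (y ^ n)) = moment ν from funext hy.moments]
    exact invertsMoments_kSeries h₂ hν
  have hsum := InvertsMoments.add_of_free hφ.map_one hfree hxI hyI
  rwa [show (fun n => φ ((x + y) ^ n)) = moment ρ from funext hxy.moments] at hsum

theorem IsFreeConvolution.isProbabilityMeasure {μ ν ρ : Measure ℝ} (h : IsFreeConvolution μ ν ρ) :
    IsProbabilityMeasure ρ ∧ ∃ M : ℝ, 0 < M ∧ ρ (Set.Icc (-M) M) = 1 := by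
  obtain ⟨A, _, _, _, _, φ, x, y, -, -, -, -, -, -, hxy⟩ := h
  exact ⟨hxy.isProbabilityMeasure, hxy.compact_support⟩

theorem measure_Icc_eq_one_of_le {ρ : Measure ℝ} [IsProbabilityMeasure ρ] {M M' : ℝ} (hM : M ≤ M')
    (h : ρ (Set.Icc (-M) M) = 1) : ρ (Set.Icc (-M') M') = 1 :=
  le_antisymm prob_le_one (h ▸ measure_mono (Set.Icc_subset_Icc (neg_le_neg hM) hM))

theorem IsFreeConvolution.unique {μ ν ρ ρ' : Measure ℝ} [IsProbabilityMeasure μ]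
    [IsProbabilityMeasure ν] {r₁ r₂ : ℝ} (h₁ : 0 < r₁) (h₂ : 0 < r₂)
    (hμ : μ (Set.Icc (-r₁) r₁) = 1) (hν : ν (Set.Icc (-r₂) r₂) = 1)
    (h : IsFreeConvolution μ ν ρ) (h' : IsFreeConvolution μ ν ρ') : ρ = ρ' := by
  have hm := (h.invertsMoments h₁ h₂ hμ hν).moments_unique (h'.invertsMoments h₁ h₂ hμ hν)
  obtain ⟨_, M, -, hM⟩ := h.isProbabilityMeasure
  obtain ⟨_, M', -, hM'⟩ := h'.isProbabilityMeasure
  exact eq_of_moment_eq (measure_Icc_eq_one_of_le (le_max_left M M') hM)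
    (measure_Icc_eq_one_of_le (le_max_right M M') hM') fun n => congrFun hm n

/-- The series of `w K(w)` of the three measures are related by `κ_ρ = κ_μ + κ_ν - 1`, because both
sides invert the moments of `ρ = μ ⊞ ν`. -/
theorem eventually_rTransform_add {μ ν ρ : Measure ℝ} [IsProbabilityMeasure μ]
    [IsProbabilityMeasure ν] {r₁ r₂ r₃ : ℝ} (h₁ : 0 < r₁) (h₂ : 0 < r₂) (h₃ : 0 < r₃)
    (hμ : μ (Set.Icc (-r₁) r₁) = 1) (hν : ν (Set.Icc (-r₂) r₂) = 1)
    (hρ : ρ (Set.Icc (-r₃) r₃) = 1) (h : IsFreeConvolution μ ν ρ) :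
    ∀ᶠ z in 𝓝 (0 : ℂ), rTransform ρ r₃ z = rTransform μ r₁ z + rTransform ν r₂ z := by
  have := h.isProbabilityMeasure.1
  have hκ := (invertsMoments_kSeries h₃ hρ).series_unique (moment_zero ρ)
    (h.invertsMoments h₁ h₂ hμ hν)
  have hR : (PowerSeries.mk fun n => freeCumulant (moment ρ) (n + 1))
      = (PowerSeries.mk fun n => freeCumulant (moment μ) (n + 1))
        + PowerSeries.mk fun n => freeCumulant (moment ν) (n + 1) := by
    refine mul_left_cancel₀ PowerSeries.X_ne_zero ?_
    simp only [kSeries] at hκ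
    linear_combination hκ
  have hsum := (hasExpansion_rTransform h₁ hμ).add (hasExpansion_rTransform h₂ hν)
  rw [← hR] at hsum
  filter_upwards [hasExpansion_rTransform h₃ hρ, hsum] with z hz hz'
  exact hz.unique hz'

end FreeProb

end

open FreeProb

theorem mainTheorem5 :
    (∀ (μ : Measure ℝ) [IsProbabilityMeasure μ] (r : ℝ), 0 < r → μ (Set.Icc (-r) r) = 1 →
      -- the Cauchy transform on `U`
      AnalyticOnNhd ℂ (cauchyTransform μ) (domU r) ∧
      Set.MapsTo (cauchyTransform μ) (domU r) {w | ‖w‖ < 1 / (3 * r)} ∧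
      Set.InjOn (cauchyTransform μ) (domU r) ∧
      domV r \ {0} ⊆ cauchyTransform μ '' domU r ∧
      0 ∉ cauchyTransform μ '' domU r ∧
      Tendsto (cauchyTransform μ) (Bornology.cobounded ℂ) (𝓝 0) ∧
      -- its inverse `K` and the function `R`
      Set.MapsTo (kTransform μ r) (domV r \ {0}) (domU r) ∧
      (∀ z ∈ domV r \ {0}, cauchyTransform μ (kTransform μ r z) = z) ∧
      meromorphicOrderAt (kTransform μ r) 0 = -1 ∧
      AnalyticOnNhd ℂ (rTransform μ r) (domV r) ∧
      (∀ z ∈ domV r \ {0}, kTransform μ r z = 1 / z + rTransform μ r z) ∧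
      (∀ z ∈ domV r \ {0}, cauchyTransform μ (rTransform μ r z + 1 / z) = z) ∧
      (∀ z : ℂ, 7 * r < ‖z‖ → cauchyTransform μ z ∈ domV r \ {0} ∧
        rTransform μ r (cauchyTransform μ z) + 1 / cauchyTransform μ z = z) ∧
      -- the power series of `R`
      (∀ z ∈ domV r,
        HasSum (fun n : ℕ => freeCumulant (moment μ) (n + 1) * z ^ n) (rTransform μ r z))) ∧
    -- free convolution
    (∀ (μ ν : Measure ℝ) [IsProbabilityMeasure μ] [IsProbabilityMeasure ν] (r₁ r₂ : ℝ),
      0 < r₁ → 0 < r₂ → μ (Set.Icc (-r₁) r₁) = 1 → ν (Set.Icc (-r₂) r₂) = 1 →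
      (∀ ρ : Measure ℝ, IsFreeConvolution μ ν ρ ↔ ρ = freeConvolution μ ν) ∧
      ∀ r₃ : ℝ, 0 < r₃ → freeConvolution μ ν (Set.Icc (-r₃) r₃) = 1 →
        ∀ᶠ z in 𝓝 (0 : ℂ), rTransform (freeConvolution μ ν) r₃ z
          = rTransform μ r₁ z + rTransform ν r₂ z) := by
  refine ⟨fun μ _ r hr hμ => ?_, fun μ ν _ _ r₁ r₂ h₁ h₂ hμ hν => ?_⟩
  · have hK : ∀ z ∈ domV r \ {0}, kTransform μ r z ∈ domU r ∧
        cauchyTransform μ (kTransform μ r z) = z := fun z hz =>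
      ⟨(kTransform_eq hr hμ hz.1 hz.2).1, (kTransform_eq hr hμ hz.1 hz.2).2.1⟩
    refine ⟨analyticOnNhd_cauchyTransform hr hμ, fun z hz => ?_, injOn_cauchyTransform hr hμ,
      fun w hw => ⟨_, (hK w hw).1, (hK w hw).2⟩, ?_, tendsto_cauchyTransform hμ,
      fun z hz => (hK z hz).1, fun z hz => (hK z hz).2, meromorphicOrderAt_kTransform hr hμ,
      analyticOnNhd_rTransform hr hμ, fun z hz => kTransform_eq_add μ r hz.2, fun z hz => ?_,
      fun z hz => ?_, fun z hz => hasSum_rTransform hr hμ hz⟩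
    · have h : ‖cauchyTransform μ z‖ < 1 / (4 * r - r) :=
        norm_cauchyTransform_lt hμ (by linarith) hz
      have e : 4 * r - r = 3 * r := by ring
      rwa [e] at h
    · rintro ⟨z, hz, h⟩
      exact cauchyTransform_ne_zero hr hμ hz h
    · rw [add_comm, ← kTransform_eq_add μ r hz.2]
      exact (hK z hz).2
    · have hzU : z ∈ domU r := show 4 * r < ‖z‖ by linarith
      have hV : cauchyTransform μ z ∈ domV r \ {0} := by
        refine ⟨?_, cauchyTransform_ne_zero hr hμ hzU⟩
        have h := norm_cauchyTransform_lt hμ (s := 7 * r) (by linarith) hz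
        have e : 7 * r - r = 6 * r := by ring
        rwa [e] at h
      refine ⟨hV, ?_⟩
      rw [add_comm, ← kTransform_eq_add μ r hV.2]
      exact injOn_cauchyTransform hr hμ (hK _ hV).1 hzU (hK _ hV).2
  · have hspec : IsFreeConvolution μ ν (freeConvolution μ ν) :=
      Classical.epsilon_spec (exists_isFreeConvolution h₁ h₂ hμ hν)
    refine ⟨fun ρ => ⟨fun h => h.unique h₁ h₂ hμ hν hspec, fun h => h ▸ hspec⟩,
      fun r₃ h₃ hρ => eventually_rTransform_add h₁ h₂ h₃ hμ hν hρ hspec⟩
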